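/- Let $\mathcal{F}_2$ be the free associative $\mathbb{F}_2$-algebra on generators $S^1,S^2,\ldots$ (put $S^0=1$), with coproduct $\Delta(S^n)=\sum_{i=0}^n S^i\otimes S^{n-i}$. Let $\mathcal{A}_2$ be the mod 2 Steenrod algebra, i.e. the quotient Hopf algebra of $\mathcal{F}_2$ by the two-sided ideal generated by the Adem relations $$S^iS^j-\sum_{k=0}^{\lfloor i/2\rfloor}\binom{j-k-1}{i-2k}S^{i+j-k}S^k\qquad(0<i<2j),$$ and let $Sq^i$ be the image of $S^i$, of degree $i$. Let $\mathcal{A}_2^*$ be the dual Steenrod algebra: the graded dual of $\mathcal{A}_2$ (the linear forms vanishing in all sufficiently large degrees) with the Hopf algebra structure dual to that of $\mathcal{A}_2$, and let $\chi$ be its conjugation (antipode). For $n\ge 0$ let $\xi_n\in\mathcal{A}_2^*$ be the unique linear form which, among the admissible monomials $Sq^{j_1}\cdots Sq^{j_r}$ ($r\ge 0$, $j_i>0$, $j_{i-1}\ge 2j_i$), takes the value $1$ on $Sq^{2^{n-1}}Sq^{2^{n-2}}\cdots Sq^{2}Sq^{1}$ and $0$ on all others (so $\xi_0=1$). Then for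 every $n\ge 0$ $$\chi(\xi_n)=\sum_{\alpha}\prod_{k=1}^{l(\alpha)}\xi_{\alpha(k)}^{2^{\sigma(k)}},$$ where $\alpha=(\alpha(1),\ldots,\alpha(l(\alpha)))$ runs through all compositions of $n$ (ordered sequences of positive integers with sum $n$) and $\sigma(k)=\sum_{j=1}^{k-1}\alpha(j)$. -/

import Mathlib

namespace Steenrod
section PS
open PowerSeries

theorem charP_ps : CharP (ZMod 2)⟦X⟧ 2 :=
  charP_of_injective_algebraMap (R := ZMod 2) (FaithfulSMul.algebraMap_injective _ _) 2

theorem ps_coeff_geom : ∃ u : (ZMod 2)⟦X⟧, (1 + X) * u = 1 ∧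
    ∀ i : ℕ, coeff i (u ^ (i + 1)) = if i = 0 then 1 else 0 := by
  have h2 : (1 + X : (ZMod 2)⟦X⟧) = 1 - X := by
    have := charP_ps
    rw [sub_eq_add_neg, CharTwo.neg_eq]
  refine ⟨(invOneSubPow (ZMod 2) 1).val, ?_, ?_⟩
  · rw [h2]
    have := (invOneSubPow (ZMod 2) 1).inv_val
    rwa [Units.inv_eq_val_inv, ← Units.inv_eq_val_inv, invOneSubPow_inv_eq_one_sub_pow, pow_one]
      at this
  · intro i
    have h3 : ∀ n, (invOneSubPow (ZMod 2) 1).val ^ n = (invOneSubPow (ZMod 2) n).val := by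
      intro n
      induction n with
      | zero => simp [invOneSubPow_zero]
      | succ n ih => rw [pow_succ, ih, invOneSubPow_add]; simp
    rw [h3, invOneSubPow_val_succ_eq_mk_add_choose, coeff_mk]
    split_ifs with h
    · simp [h]
    · have := Nat.two_dvd_centralBinom_of_one_le (Nat.pos_of_ne_zero h)
      rw [Nat.centralBinom, two_mul] at this
      exact (ZMod.natCast_eq_zero_iff _ _).2 this

/-- A binomial coefficient that is even. -/
theorem choose_two_pow_sub (m i j : ℕ) (hi : 0 < i) (h : i + j = 2 ^ m) :
    ((j - 1).choose i : ZMod 2) = 0 := by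
  obtain ⟨u, hu, hc⟩ := ps_coeff_geom
  rcases Nat.eq_zero_or_pos j with rfl | hj
  · simp [Nat.choose_eq_zero_of_lt hi]
  have h1 : (1 + X : (ZMod 2)⟦X⟧) ^ (j - 1) = u ^ (i + 1) + X ^ (2 ^ m) * u ^ (i + 1) := by
    calc (1 + X : (ZMod 2)⟦X⟧) ^ (j - 1)
        = (1 + X) ^ (j - 1) * ((1 + X) * u) ^ (i + 1) := by rw [hu]; simp
      _ = (1 + X) ^ (2 ^ m) * u ^ (i + 1) := by
          rw [mul_pow, ← mul_assoc, ← pow_add]; congr 2; omega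
      _ = _ := by have := charP_ps; rw [add_pow_char_pow]; ring
  have h2 := congrArg (coeff i) h1
  rw [map_add, coeff_X_pow_mul', hc, if_neg hi.ne', if_neg (by omega)] at h2
  rw [← h2.trans (add_zero 0)]
  have : (1 + X : (ZMod 2)⟦X⟧) ^ (j - 1) = ((1 + Polynomial.X : Polynomial (ZMod 2)) ^ (j - 1) : Polynomial (ZMod 2)) := by
    simp
  rw [this, Polynomial.coeff_coe, Polynomial.coeff_one_add_X_pow]

/-- The binomial identity behind the Adem relations. -/
theorem adem_binomial (i j : ℕ) (h : i < 2 * j) :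
    ((i + j).choose j : ZMod 2) = ∑ l ∈ Finset.range (i / 2 + 1),
      ((j - l - 1).choose (i - 2 * l) : ZMod 2) * ((i + j).choose l : ZMod 2) := by
  obtain ⟨u, hu, hc⟩ := ps_coeff_geom
  have hrec : ∀ N i : ℕ, coeff i (u ^ (i + 1) * (1 + X * (1 + X)) ^ N) = (N.choose i : ZMod 2) := by
    intro N
    induction N with
    | zero =>
      intro i; rw [pow_zero, mul_one, hc]
      rcases i with _ | i <;> simp
    | succ N ih =>
      intro i
      rcases i with _ | i
      · have := ih 0
        simp only [coeff_zero_eq_constantCoeff, map_mul, map_pow, map_add, map_one,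
          constantCoeff_X] at this ⊢
        simpa using this
      · have : u ^ (i + 1 + 1) * (1 + X * (1 + X)) ^ (N + 1) =
            u ^ (i + 1 + 1) * (1 + X * (1 + X)) ^ N +
            X * (u ^ (i + 1) * (1 + X * (1 + X)) ^ N) * ((1 + X) * u) := by ring
        rw [this, hu, mul_one, map_add, ih, coeff_succ_X_mul, ih, Nat.choose_succ_succ]
        push_cast; ring
  rw [Nat.choose_symm_add.symm, ← hrec (i + j) i]
  have hx : (1 + X * (1 + X) : (ZMod 2)⟦X⟧) = X ^ 2 + (1 + X) := by ring
  rw [hx, add_pow, Finset.mul_sum, map_sum]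
  have hz : ∀ l, i < 2 * l → coeff i (u ^ (i + 1) * ((X ^ 2) ^ l * (1 + X) ^ (i + j - l) *
      ((i + j).choose l : (ZMod 2)⟦X⟧))) = 0 := by
    intro l hl
    have : u ^ (i + 1) * ((X ^ 2) ^ l * (1 + X) ^ (i + j - l) *
      ((i + j).choose l : (ZMod 2)⟦X⟧)) = X ^ (2 * l) * (u ^ (i + 1) * ((1 + X) ^ (i + j - l) *
      ((i + j).choose l : (ZMod 2)⟦X⟧))) := by ring
    rw [this, coeff_X_pow_mul', if_neg (by omega)]
  rw [← Finset.sum_subset (s₁ := Finset.range (i / 2 + 1))]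
  · refine Finset.sum_congr rfl fun l hl => ?_
    rw [Finset.mem_range] at hl
    have h1 : u ^ (i + 1) * ((X ^ 2) ^ l * (1 + X) ^ (i + j - l) *
      ((i + j).choose l : (ZMod 2)⟦X⟧)) =
        X ^ (2 * l) * ((1 + X) ^ (j - l - 1) * C ((i + j).choose l : ZMod 2)) := by
      have : i + j - l = (j - l - 1) + (i + 1) := by omega
      rw [this, pow_add]
      calc _ = X ^ (2 * l) * ((1 + X) ^ (j - l - 1) * (((i + j).choose l : (ZMod 2)⟦X⟧))) *
            ((1 + X) * u) ^ (i + 1) := by rw [mul_pow (1 + X) u]; ring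
        _ = _ := by rw [hu]; simp
    rw [h1, coeff_X_pow_mul', if_pos (by omega), coeff_mul_C]
    congr 1
    have : (1 + X : (ZMod 2)⟦X⟧) ^ (j - l - 1) = ((1 + Polynomial.X : Polynomial (ZMod 2)) ^ (j - l - 1) : Polynomial (ZMod 2)) := by
      simp
    rw [this, Polynomial.coeff_coe, Polynomial.coeff_one_add_X_pow]
  · intro l hl
    simp only [Finset.mem_range] at *
    omega
  · intro l _ hl
    simp only [Finset.mem_range] at hl
    exact hz l (by omega)
end PS

section Kappa
open Polynomial
open Finset.HasAntidiagonal (antidiagonal)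

/-- The coefficient of `x ^ i * y ^ j` in `(x + y) ^ a * (x ^ 2 * y) ^ b` over `𝔽₂`. -/
noncomputable def kappa (a b i j : ℕ) : ZMod 2 :=
  ((((X + C X) ^ a * (C (X ^ 2) * X) ^ b : (ZMod 2)[X][X])).coeff j).coeff i

theorem kappa_eq (a b i j : ℕ) : kappa a b i j =
    if b ≤ j ∧ a + 3 * b = i + j then (a.choose (j - b) : ZMod 2) else 0 := by
  have h1 : ((X + C X) ^ a * (C (X ^ 2) * X) ^ b : (ZMod 2)[X][X]) =
      (C (X ^ (2 * b)) * (X + C X) ^ a) * X ^ b := by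
    rw [mul_pow, ← C_pow, ← pow_mul]; ring
  rw [kappa, h1, coeff_mul_X_pow']
  by_cases hb : b ≤ j
  · rw [if_pos hb, coeff_C_mul, coeff_X_add_C_pow, ← mul_assoc, ← pow_add,
      ← C_eq_natCast, coeff_mul_C, coeff_X_pow]
    by_cases hj : a < j - b
    · simp [Nat.choose_eq_zero_of_lt hj]
    · simp only [hb, true_and]
      by_cases h : a + 3 * b = i + j
      · rw [if_pos h, if_pos (by omega), one_mul]
      · rw [if_neg h, if_neg (by omega), zero_mul]
  · rw [if_neg hb]; simp [hb]

theorem kappa_zero_of_lt {a b i j : ℕ} (h : i + j < a ∨ i + j < b) : kappa a b i j = 0 := by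
  rw [kappa_eq, if_neg (by omega)]

theorem kappa_zero_zero (i j : ℕ) : kappa 0 0 i j = if i = 0 ∧ j = 0 then 1 else 0 := by
  rw [kappa_eq]
  by_cases h : i = 0 ∧ j = 0
  · simp [h.1, h.2]
  · rw [if_neg h, if_neg (by omega)]

theorem kappa_mul (a b a' b' i j : ℕ) :
    ∑ p ∈ antidiagonal j, ∑ q ∈ antidiagonal i,
      kappa a b q.1 p.1 * kappa a' b' q.2 p.2 = kappa (a + a') (b + b') i j := by
  have : ((X + C X) ^ (a + a') * (C (X ^ 2) * X) ^ (b + b') : (ZMod 2)[X][X]) =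
    ((X + C X) ^ a * (C (X ^ 2) * X) ^ b) * ((X + C X) ^ a' * (C (X ^ 2) * X) ^ b') := by ring
  rw [kappa, this, coeff_mul, finsetSum_coeff]
  refine Finset.sum_congr rfl fun p _ => ?_
  rw [coeff_mul]; rfl

theorem kappa_adem (a b i j : ℕ) (hi : 0 < i) (hij : i < 2 * j) :
    kappa a b i j = ∑ k ∈ Finset.range (i / 2 + 1),
      ((j - k - 1).choose (i - 2 * k) : ZMod 2) * kappa a b (i + j - k) k := by
  by_cases hab : a + 3 * b = i + j
  swap
  · rw [kappa_eq, if_neg (by tauto)]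
    refine (Finset.sum_eq_zero fun k hk => ?_).symm
    rw [Finset.mem_range] at hk
    rw [kappa_eq, if_neg (by omega), mul_zero]
  by_cases h2 : 2 * b ≤ i
  · have hI := adem_binomial (i - 2 * b) (j - b) (by omega)
    have ha : i - 2 * b + (j - b) = a := by omega
    rw [ha] at hI
    rw [kappa_eq, if_pos (by omega), hI]
    have hs : i / 2 + 1 = b + ((i - 2 * b) / 2 + 1) := by omega
    rw [hs, Finset.sum_range_add _ b]
    rw [Finset.sum_eq_zero (s := Finset.range b), zero_add]
    · refine Finset.sum_congr rfl fun l hl => ?_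
      rw [Finset.mem_range] at hl
      rw [kappa_eq, if_pos (by omega)]
      congr 3 <;> omega
    · intro k hk
      rw [Finset.mem_range] at hk
      rw [kappa_eq, if_neg (by omega), mul_zero]
  · rw [Finset.sum_eq_zero]
    · rw [kappa_eq]
      split_ifs with h
      · rw [Nat.choose_eq_zero_of_lt (by omega)]; simp
      · rfl
    · intro k hk
      rw [Finset.mem_range] at hk
      rw [kappa_eq, if_neg (by omega), mul_zero]

end Kappa

section Expand
open Finset.HasAntidiagonal (antidiagonal)

variable {B B' B'' : Type*} [AddCommGroup B] [Module (ZMod 2) B] [AddCommGroup B']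
  [Module (ZMod 2) B'] [AddCommGroup B''] [Module (ZMod 2) B'']

/-- The Adem relations for a doubly indexed family `v i j` (in place of `Sq i * Sq j`). -/
def AdemRelations (v : ℕ → ℕ → B) : Prop :=
  ∀ i j : ℕ, 0 < i → i < 2 * j → v i j = ∑ k ∈ Finset.range (i / 2 + 1),
    ((j - k - 1).choose (i - 2 * k) : ZMod 2) • v (i + j - k) k

/-- The coefficient of `x ^ i * y ^ j` in `∑ m a b * (x + y) ^ a * (x ^ 2 * y) ^ b`. -/
noncomputable def expand (m : ℕ → ℕ → B) (i j : ℕ) : B :=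
  ∑ a ∈ Finset.range (i + j + 1), ∑ b ∈ Finset.range (i + j + 1), kappa a b i j • m a b

theorem expand_eq (m : ℕ → ℕ → B) {i j M : ℕ} (h : i + j < M) :
    expand m i j = ∑ a ∈ Finset.range M, ∑ b ∈ Finset.range M, kappa a b i j • m a b := by
  have hs : Finset.range (i + j + 1) ⊆ Finset.range M := by
    intro x; simp only [Finset.mem_range]; omega
  rw [expand, ← Finset.sum_subset hs]
  · refine Finset.sum_congr rfl fun a _ => Finset.sum_subset hs fun b _ hb => ?_
    rw [kappa_zero_of_lt (by simp only [Finset.mem_range] at hb; omega), zero_smul]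
  · intro a _ ha
    refine Finset.sum_eq_zero fun b _ => ?_
    rw [kappa_zero_of_lt (by simp only [Finset.mem_range] at ha; omega), zero_smul]

theorem ademRelations_expand (m : ℕ → ℕ → B) : AdemRelations (expand m) := by
  intro i j hi hij
  have h : ∀ k ∈ Finset.range (i / 2 + 1),
      ((j - k - 1).choose (i - 2 * k) : ZMod 2) • expand m (i + j - k) k =
      ∑ a ∈ Finset.range (i + j + 1), ∑ b ∈ Finset.range (i + j + 1),
        (((j - k - 1).choose (i - 2 * k) : ZMod 2) * kappa a b (i + j - k) k) • m a b := by
    intro k hk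
    rw [Finset.mem_range] at hk
    rw [expand_eq m (show i + j - k + k < i + j + 1 by omega)]
    simp only [Finset.smul_sum, smul_smul]
  rw [Finset.sum_congr rfl h, Finset.sum_comm, expand]
  refine Finset.sum_congr rfl fun a _ => ?_
  rw [Finset.sum_comm]
  refine Finset.sum_congr rfl fun b _ => ?_
  rw [← Finset.sum_smul, kappa_adem a b i j hi hij]

theorem triangular_solve (v : ℕ → B) (c : ℕ → ℕ → ZMod 2) (hc : ∀ j, c j j = 1) :
    ∃ w : ℕ → B, ∀ j, v j = ∑ b ∈ Finset.range (j + 1), c j b • w b := by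
  let w : ℕ → B := fun j => Nat.strongRec (motive := fun _ => B)
    (fun j ih => v j - ∑ b : Fin j, c j b • ih b b.2) j
  refine ⟨w, fun j => ?_⟩
  have hw : w j = v j - ∑ b ∈ Finset.range j, c j b • w b := by
    rw [← Fin.sum_univ_eq_sum_range (fun b => c j b • w b)]
    conv_lhs => simp only [w]; rw [Nat.strongRec_eq]
  rw [Finset.sum_range_succ, hc, one_smul, hw]
  abel

theorem expand_of_le (m : ℕ → ℕ → B) {i j : ℕ} (h : 2 * j ≤ i) :
    expand m i j = ∑ b ∈ Finset.range (j + 1),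
      ((i + j - 3 * b).choose (j - b) : ZMod 2) • m (i + j - 3 * b) b := by
  rw [expand, Finset.sum_comm]
  have hs : Finset.range (j + 1) ⊆ Finset.range (i + j + 1) := by
    intro x; simp only [Finset.mem_range]; omega
  rw [← Finset.sum_subset hs]
  · refine Finset.sum_congr rfl fun b hb => ?_
    rw [Finset.mem_range] at hb
    rw [Finset.sum_eq_single (i + j - 3 * b)]
    · rw [kappa_eq, if_pos (by omega)]
    · intro a _ ha
      rw [kappa_eq, if_neg (by omega), zero_smul]
    · intro h; simp only [Finset.mem_range] at h; omega
  · intro b _ hb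
    refine Finset.sum_eq_zero fun a _ => ?_
    simp only [Finset.mem_range] at hb
    rw [kappa_eq, if_neg (by omega), zero_smul]

theorem expand_zero_left (m : ℕ → ℕ → B) (n : ℕ) : expand m 0 n = expand m n 0 := by
  rw [expand, expand]
  simp only [zero_add, add_zero]
  refine Finset.sum_congr rfl fun a _ => Finset.sum_congr rfl fun b _ => ?_
  congr 1
  rw [kappa_eq, kappa_eq]
  by_cases hb : b = 0
  · subst hb
    by_cases ha : a = n
    · simp [ha]
    · rw [if_neg (by omega), if_neg (by omega)]
  · rw [if_neg (c := b ≤ 0 ∧ _) (by omega)]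
    split_ifs with h
    · rw [Nat.choose_eq_zero_of_lt (by omega)]; simp
    · rfl

/-- A family that satisfies the Adem relations comes from an expansion. -/
theorem AdemRelations.exists_expand {v : ℕ → ℕ → B} (hv : AdemRelations v)
    (h0 : ∀ n, v 0 n = v n 0) : ∃ m, v = expand m := by
  choose w hw using fun n => triangular_solve (fun j => v (n - j) j)
    (fun j b => ((n - 3 * b).choose (j - b) : ZMod 2)) (by simp)
  have hadm : ∀ i j, 2 * j ≤ i → v i j = expand (fun a b => w (a + 3 * b) b) i j := by
    intro i j h
    have := hw (i + j) j
    simp only [Nat.add_sub_cancel] at this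
    rw [this, expand_of_le _ h]
    refine Finset.sum_congr rfl fun b hb => ?_
    rw [Finset.mem_range] at hb
    rw [Nat.sub_add_cancel (by omega)]
  refine ⟨fun a b => w (a + 3 * b) b, ?_⟩
  funext i j
  by_cases h : 2 * j ≤ i
  · exact hadm i j h
  rcases Nat.eq_zero_or_pos i with rfl | hi
  · rw [h0, hadm j 0 (by omega), expand_zero_left]
  · rw [hv i j hi (by omega), ademRelations_expand _ i j hi (by omega)]
    refine Finset.sum_congr rfl fun k hk => ?_
    rw [Finset.mem_range] at hk
    rw [hadm _ k (by omega)]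

theorem sum_range_antidiagonal {E : Type*} [AddCommMonoid E] (M : ℕ) (F : ℕ → ℕ → ℕ → E)
    (hF : ∀ s x y, M ≤ s → F s x y = 0) :
    ∑ a ∈ Finset.range M, ∑ p ∈ antidiagonal a, F a p.1 p.2 =
      ∑ x ∈ Finset.range M, ∑ y ∈ Finset.range M, F (x + y) x y := by
  rw [← Finset.sum_product', ← Finset.sum_filter_of_ne
    (p := fun z : ℕ × ℕ => z.1 + z.2 ∈ Finset.range M)]
  · rw [← Finset.sum_fiberwise_of_maps_to (t := Finset.range M) (g := fun z : ℕ × ℕ => z.1 + z.2)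
      (fun z hz => (Finset.mem_filter.1 hz).2)]
    refine Finset.sum_congr rfl fun a ha => ?_
    rw [Finset.mem_range] at ha
    have : antidiagonal a = Finset.filter (fun z : ℕ × ℕ => z.1 + z.2 = a)
        (Finset.filter (fun z : ℕ × ℕ => z.1 + z.2 ∈ Finset.range M)
          (Finset.range M ×ˢ Finset.range M)) := by
      ext z
      simp only [Finset.HasAntidiagonal.mem_antidiagonal, Finset.mem_filter, Finset.mem_product,
        Finset.mem_range]
      omega
    rw [this]
    refine Finset.sum_congr rfl fun z hz => ?_
    rw [(Finset.mem_filter.1 hz).2]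
  · intro z _ hz
    rw [Finset.mem_range]
    by_contra h
    exact hz (hF _ _ _ (not_lt.1 h))

/-- Convolution of doubly indexed families along a bilinear map. -/
def convolve (β : B →ₗ[ZMod 2] B' →ₗ[ZMod 2] B'') (m : ℕ → ℕ → B) (m' : ℕ → ℕ → B')
    (a b : ℕ) : B'' :=
  ∑ p ∈ antidiagonal b, ∑ q ∈ antidiagonal a, β (m q.1 p.1) (m' q.2 p.2)

theorem convolve_expand (β : B →ₗ[ZMod 2] B' →ₗ[ZMod 2] B'') (m : ℕ → ℕ → B)
    (m' : ℕ → ℕ → B') :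
    convolve β (expand m) (expand m') = expand (convolve β m m') := by
  funext i j
  have hR : expand (convolve β m m') i j = ∑ a ∈ Finset.range (i + j + 1),
      ∑ a' ∈ Finset.range (i + j + 1), ∑ b ∈ Finset.range (i + j + 1),
      ∑ b' ∈ Finset.range (i + j + 1), kappa (a + a') (b + b') i j • β (m a b) (m' a' b') := by
    have h1 : expand (convolve β m m') i j = ∑ a ∈ Finset.range (i + j + 1),
      ∑ q ∈ antidiagonal a, ∑ b ∈ Finset.range (i + j + 1),
      ∑ p ∈ antidiagonal b, kappa a b i j • β (m q.1 p.1) (m' q.2 p.2) := by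
      rw [expand]
      refine Finset.sum_congr rfl fun a _ => ?_
      rw [Finset.sum_comm (s := antidiagonal a)]
      refine Finset.sum_congr rfl fun b _ => ?_
      rw [convolve, Finset.smul_sum, Finset.sum_comm]
      simp only [Finset.smul_sum]
    rw [h1, sum_range_antidiagonal (i + j + 1) (fun a x y => ∑ b ∈ Finset.range (i + j + 1),
      ∑ p ∈ antidiagonal b, kappa a b i j • β (m x p.1) (m' y p.2))]
    · refine Finset.sum_congr rfl fun a _ => Finset.sum_congr rfl fun a' _ => ?_
      rw [sum_range_antidiagonal (i + j + 1) (fun b x y => kappa (a + a') b i j • β (m a x) (m' a' y))]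
      intro s x y hs
      rw [kappa_zero_of_lt (by omega), zero_smul]
    · intro s x y hs
      refine Finset.sum_eq_zero fun b _ => Finset.sum_eq_zero fun p _ => ?_
      rw [kappa_zero_of_lt (by omega), zero_smul]
  have hL : ∀ p ∈ antidiagonal j, ∀ q ∈ antidiagonal i,
      β (expand m q.1 p.1) (expand m' q.2 p.2) = ∑ a ∈ Finset.range (i + j + 1),
      ∑ a' ∈ Finset.range (i + j + 1), ∑ b ∈ Finset.range (i + j + 1),
      ∑ b' ∈ Finset.range (i + j + 1),
        (kappa a b q.1 p.1 * kappa a' b' q.2 p.2) • β (m a b) (m' a' b') := by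
    intro p hp q hq
    rw [Finset.HasAntidiagonal.mem_antidiagonal] at hp hq
    rw [expand_eq m (show q.1 + p.1 < i + j + 1 by omega),
      expand_eq m' (show q.2 + p.2 < i + j + 1 by omega), LinearMap.map_sum₂]
    refine Finset.sum_congr rfl fun a _ => ?_
    rw [map_sum]
    refine Finset.sum_congr rfl fun a' _ => ?_
    rw [LinearMap.map_sum₂]
    refine Finset.sum_congr rfl fun b _ => ?_
    rw [map_sum]
    refine Finset.sum_congr rfl fun b' _ => ?_
    rw [map_smul, map_smul, LinearMap.smul_apply, smul_smul, mul_comm]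
  rw [hR, convolve, Finset.sum_congr rfl fun p hp => Finset.sum_congr rfl (hL p hp)]
  simp only [Finset.sum_comm (s := antidiagonal i) (t := Finset.range (i + j + 1)),
    Finset.sum_comm (s := antidiagonal j) (t := Finset.range (i + j + 1))]
  simp only [← Finset.sum_smul, kappa_mul]
end Expand

section Algebras
open Finset.HasAntidiagonal (antidiagonal)
open scoped TensorProduct

/-- The mod 2 Leibniz-Hopf algebra: the free associative `𝔽₂`-algebra on `S¹, S², S³, …`. -/
abbrev LeibnizHopf : Type := FreeAlgebra (ZMod 2) ℕ+

/-- The generators `Sⁿ`, with the convention `S⁰ = 1`. -/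
noncomputable def S (n : ℕ) : LeibnizHopf :=
  if h : 0 < n then FreeAlgebra.ι (ZMod 2) (n.toPNat h) else 1

/-- The coproduct of the Leibniz-Hopf algebra: the algebra map with
`Δ(Sⁿ) = ∑_{i + j = n} Sⁱ ⊗ Sʲ`. -/
noncomputable def leibnizComul : LeibnizHopf →ₐ[ZMod 2] LeibnizHopf ⊗[ZMod 2] LeibnizHopf :=
  FreeAlgebra.lift (ZMod 2) fun n : ℕ+ => ∑ p ∈ antidiagonal (n : ℕ), S p.1 ⊗ₜ[ZMod 2] S p.2

/-- The counit of the Leibniz-Hopf algebra. -/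
noncomputable def leibnizCounit : LeibnizHopf →ₐ[ZMod 2] ZMod 2 :=
  FreeAlgebra.lift (ZMod 2) fun _ => 0

/-- The Adem relations, for `0 < i < 2 * j`. -/
inductive AdemRel : LeibnizHopf → LeibnizHopf → Prop
  | adem (i j : ℕ) (hi : 0 < i) (hij : i < 2 * j) : AdemRel (S i * S j)
      (∑ k ∈ Finset.range (i / 2 + 1),
        ((j - k - 1).choose (i - 2 * k) : ZMod 2) • (S (i + j - k) * S k))

/-- The mod 2 Steenrod algebra: the quotient of the Leibniz-Hopf algebra by the two-sided ideal
generated by the Adem relations. -/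
def SteenrodAlgebra : Type := RingQuot AdemRel

noncomputable instance : Ring SteenrodAlgebra := inferInstanceAs (Ring (RingQuot AdemRel))

noncomputable instance : Algebra (ZMod 2) SteenrodAlgebra :=
  inferInstanceAs (Algebra (ZMod 2) (RingQuot AdemRel))

/-- The quotient map `π`. -/
noncomputable def proj : LeibnizHopf →ₐ[ZMod 2] SteenrodAlgebra :=
  RingQuot.mkAlgHom (ZMod 2) AdemRel

/-- The Steenrod squares `Sqⁿ = π(Sⁿ)`. -/
noncomputable def Sq (n : ℕ) : SteenrodAlgebra := proj (S n)

/-- The monomial `Sq^J = Sq^{j₁} Sq^{j₂} ⋯` of a sequence `J`. -/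
noncomputable def SqWord (J : List ℕ) : SteenrodAlgebra := (J.map Sq).prod

theorem S_zero : S 0 = 1 := by simp [S]

theorem S_coe (n : ℕ+) : S n = FreeAlgebra.ι (ZMod 2) n := by
  rw [S, dif_pos n.pos]; rfl

theorem Sq_zero : Sq 0 = 1 := by rw [Sq, S_zero, map_one]

theorem lift_S {B : Type*} [Ring B] [Algebra (ZMod 2) B] (q : ℕ → B) (h0 : q 0 = 1) (n : ℕ) :
    FreeAlgebra.lift (ZMod 2) (fun n : ℕ+ => q n) (S n) = q n := by
  rw [S]
  split_ifs with h
  · rw [FreeAlgebra.lift_ι_apply]; rfl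
  · rw [map_one, Nat.eq_zero_of_not_pos h, h0]

theorem ademRelations_Sq : AdemRelations (fun i j => Sq i * Sq j) := by
  intro i j hi hij
  have := RingQuot.mkAlgHom_rel (ZMod 2) (AdemRel.adem i j hi hij)
  simp only [map_mul, map_sum, map_smul] at this
  exact this

theorem exists_expand_Sq : ∃ m, (fun i j => Sq i * Sq j) = expand m :=
  ademRelations_Sq.exists_expand (by simp [Sq_zero])

theorem respects_adem {B : Type*} [Ring B] [Algebra (ZMod 2) B] (f : LeibnizHopf →ₐ[ZMod 2] B)
    (hf : AdemRelations fun i j => f (S i) * f (S j)) ⦃x y : LeibnizHopf⦄ (h : AdemRel x y) :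
    f x = f y := by
  obtain ⟨i, j, hi, hij⟩ := h
  simpa only [map_mul, map_sum, map_smul] using hf i j hi hij

/-- An algebra map out of the Leibniz-Hopf algebra that respects the Adem relations. -/
noncomputable def liftAdem {B : Type*} [Ring B] [Algebra (ZMod 2) B]
    (f : LeibnizHopf →ₐ[ZMod 2] B) (hf : AdemRelations fun i j => f (S i) * f (S j)) :
    SteenrodAlgebra →ₐ[ZMod 2] B :=
  RingQuot.liftAlgHom (ZMod 2) ⟨f, respects_adem f hf⟩

theorem liftAdem_proj {B : Type*} [Ring B] [Algebra (ZMod 2) B]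
    (f : LeibnizHopf →ₐ[ZMod 2] B) (hf : AdemRelations fun i j => f (S i) * f (S j))
    (x : LeibnizHopf) : liftAdem f hf (proj x) = f x :=
  RingQuot.liftAlgHom_mkAlgHom_apply _ _ _ _

theorem proj_surjective : Function.Surjective proj := RingQuot.mkAlgHom_surjective _ _

theorem algHom_ext_Sq {B : Type*} [Ring B] [Algebra (ZMod 2) B]
    {f g : SteenrodAlgebra →ₐ[ZMod 2] B} (h : ∀ n, f (Sq n) = g (Sq n)) : f = g := by
  have : f.comp proj = g.comp proj := by
    refine FreeAlgebra.hom_ext (funext fun n => ?_)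
    have := h n
    rw [Sq, S_coe] at this
    exact this
  ext x
  obtain ⟨y, rfl⟩ := proj_surjective x
  exact DFunLike.congr_fun this y

theorem leibnizComul_S (n : ℕ) :
    leibnizComul (S n) = ∑ p ∈ antidiagonal n, S p.1 ⊗ₜ[ZMod 2] S p.2 :=
  lift_S (fun n => ∑ p ∈ antidiagonal n, S p.1 ⊗ₜ[ZMod 2] S p.2)
    (by simp [S_zero, Algebra.TensorProduct.one_def]) n

theorem leibnizCounit_S (n : ℕ) : leibnizCounit (S n) = if n = 0 then 1 else 0 := by
  rw [← lift_S (fun n : ℕ => if n = 0 then (1 : ZMod 2) else 0) (by simp) n, leibnizCounit]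
  congr 2
  funext n
  rw [if_neg n.ne_zero]

theorem map_proj_leibnizComul_S (n : ℕ) :
    (Algebra.TensorProduct.map proj proj).comp leibnizComul (S n) =
      ∑ p ∈ antidiagonal n, Sq p.1 ⊗ₜ[ZMod 2] Sq p.2 := by
  rw [AlgHom.comp_apply, leibnizComul_S, map_sum]
  rfl

theorem ademRelations_comul : AdemRelations fun i j =>
    (Algebra.TensorProduct.map proj proj).comp leibnizComul (S i) *
      (Algebra.TensorProduct.map proj proj).comp leibnizComul (S j) := by
  obtain ⟨m, hm⟩ := exists_expand_Sq
  have h : (fun i j =>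
    (Algebra.TensorProduct.map proj proj).comp leibnizComul (S i) *
      (Algebra.TensorProduct.map proj proj).comp leibnizComul (S j)) =
      convolve (TensorProduct.mk (ZMod 2) SteenrodAlgebra SteenrodAlgebra)
        (fun i j => Sq i * Sq j) (fun i j => Sq i * Sq j) := by
    funext i j
    rw [map_proj_leibnizComul_S, map_proj_leibnizComul_S, Finset.sum_mul_sum, convolve,
      Finset.sum_comm]
    simp only [Algebra.TensorProduct.tmul_mul_tmul, TensorProduct.mk_apply]
  rw [h, hm, convolve_expand]
  exact ademRelations_expand _

theorem ademRelations_counit : AdemRelations fun i j =>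
    leibnizCounit (S i) * leibnizCounit (S j) := by
  intro i j hi hij
  simp only
  rw [leibnizCounit_S i, if_neg hi.ne', zero_mul]
  refine (Finset.sum_eq_zero fun k hk => ?_).symm
  rw [Finset.mem_range] at hk
  rw [leibnizCounit_S, if_neg (by omega), zero_mul, smul_zero]

/-- The coproduct of the Steenrod algebra, induced by the one of the Leibniz-Hopf algebra. -/
noncomputable def comulAux : SteenrodAlgebra →ₐ[ZMod 2] SteenrodAlgebra ⊗[ZMod 2] SteenrodAlgebra :=
  liftAdem ((Algebra.TensorProduct.map proj proj).comp leibnizComul) ademRelations_comul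

/-- The counit of the Steenrod algebra, induced by the one of the Leibniz-Hopf algebra. -/
noncomputable def counitAux : SteenrodAlgebra →ₐ[ZMod 2] ZMod 2 :=
  liftAdem leibnizCounit ademRelations_counit

theorem comulAux_Sq (n : ℕ) :
    comulAux (Sq n) = ∑ p ∈ antidiagonal n, Sq p.1 ⊗ₜ[ZMod 2] Sq p.2 :=
  (liftAdem_proj _ _ _).trans (map_proj_leibnizComul_S n)

theorem counitAux_Sq (n : ℕ) : counitAux (Sq n) = if n = 0 then 1 else 0 :=
  (liftAdem_proj _ _ _).trans (leibnizCounit_S n)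

theorem sum_antidiagonal_assoc {E : Type*} [AddCommMonoid E] (F : ℕ → ℕ → ℕ → E) (n : ℕ) :
    ∑ p ∈ antidiagonal n, ∑ q ∈ antidiagonal p.1, F q.1 q.2 p.2 =
      ∑ p ∈ antidiagonal n, ∑ q ∈ antidiagonal p.2, F p.1 q.1 q.2 := by
  rw [Finset.sum_sigma', Finset.sum_sigma']
  refine Finset.sum_bij' (fun x _ => ⟨(x.2.1, x.2.2 + x.1.2), (x.2.2, x.1.2)⟩)
    (fun x _ => ⟨(x.1.1 + x.2.1, x.2.2), (x.1.1, x.2.1)⟩) ?_ ?_ ?_ ?_ ?_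
  all_goals
    rintro ⟨⟨a, b⟩, ⟨c, d⟩⟩ h
    simp only [Finset.mem_sigma, Finset.HasAntidiagonal.mem_antidiagonal] at h ⊢
  · obtain ⟨h1, rfl⟩ := h
    simpa using by omega
  · obtain ⟨h1, rfl⟩ := h
    simpa using by omega
  · simp [h.2]
  · simp [h.2]

noncomputable instance : Bialgebra (ZMod 2) SteenrodAlgebra :=
  Bialgebra.ofAlgHom comulAux counitAux
    (algHom_ext_Sq fun n => by
      have := sum_antidiagonal_assoc
        (fun a b c => Sq a ⊗ₜ[ZMod 2] (Sq b ⊗ₜ[ZMod 2] Sq c)) n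
      simpa [comulAux_Sq, TensorProduct.sum_tmul, TensorProduct.tmul_sum] using this)
    (algHom_ext_Sq fun n => by
      have : ∀ p ∈ antidiagonal n, (if p.1 = 0 then (1 : ZMod 2) else 0) ⊗ₜ[ZMod 2] Sq p.2 =
          if p = (0, n) then 1 ⊗ₜ[ZMod 2] Sq n else 0 := by
        intro p hp
        rw [Finset.HasAntidiagonal.mem_antidiagonal] at hp
        by_cases h : p.1 = 0
        · have h2 : p = (0, n) := by ext <;> simp <;> omega
          simp [h2]
        · have h2 : p ≠ (0, n) := by rintro rfl; exact h rfl
          simp [h, h2]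
      simp only [AlgHom.comp_apply, comulAux_Sq, map_sum, Algebra.TensorProduct.map_tmul,
        counitAux_Sq, AlgHom.id_apply]
      rw [Finset.sum_congr rfl this]
      simp)
    (algHom_ext_Sq fun n => by
      have : ∀ p ∈ antidiagonal n, Sq p.1 ⊗ₜ[ZMod 2] (if p.2 = 0 then (1 : ZMod 2) else 0) =
          if p = (n, 0) then Sq n ⊗ₜ[ZMod 2] 1 else 0 := by
        intro p hp
        rw [Finset.HasAntidiagonal.mem_antidiagonal] at hp
        by_cases h : p.2 = 0
        · have h2 : p = (n, 0) := by ext <;> simp <;> omega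
          simp [h2]
        · have h2 : p ≠ (n, 0) := by rintro rfl; exact h rfl
          simp [h, h2]
      simp only [AlgHom.comp_apply, comulAux_Sq, map_sum, Algebra.TensorProduct.map_tmul,
        counitAux_Sq, AlgHom.id_apply]
      rw [Finset.sum_congr rfl this]
      simp)

theorem comul_Sq (n : ℕ) : Coalgebra.comul (R := ZMod 2) (Sq n) =
    ∑ p ∈ antidiagonal n, Sq p.1 ⊗ₜ[ZMod 2] Sq p.2 := comulAux_Sq n

theorem counit_Sq (n : ℕ) : Coalgebra.counit (R := ZMod 2) (Sq n) = if n = 0 then 1 else 0 :=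
  counitAux_Sq n

instance : Coalgebra.IsCocomm (ZMod 2) SteenrodAlgebra where
  comm_comp_comul := by
    have : (Algebra.TensorProduct.comm (ZMod 2) SteenrodAlgebra SteenrodAlgebra).toAlgHom.comp
        comulAux = comulAux := algHom_ext_Sq fun n => by
      simp only [AlgHom.comp_apply, comulAux_Sq, map_sum]
      rw [← Finset.Nat.sum_antidiagonal_swap]
      rfl
    exact congrArg AlgHom.toLinearMap this

theorem SqWord_append (I J : List ℕ) : SqWord (I ++ J) = SqWord I * SqWord J := by
  simp [SqWord]

theorem SqWord_cons (n : ℕ) (J : List ℕ) : SqWord (n :: J) = Sq n * SqWord J := by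
  simp [SqWord]

theorem SqWord_nil : SqWord [] = 1 := rfl

theorem SqWord_singleton (n : ℕ) : SqWord [n] = Sq n := by simp [SqWord]

theorem span_SqWord : Submodule.span (ZMod 2) (Set.range SqWord) = ⊤ := by
  rw [eq_top_iff]
  rintro x -
  obtain ⟨y, rfl⟩ := proj_surjective x
  have hmul : ∀ a ∈ Submodule.span (ZMod 2) (Set.range SqWord),
      ∀ b ∈ Submodule.span (ZMod 2) (Set.range SqWord),
        a * b ∈ Submodule.span (ZMod 2) (Set.range SqWord) := by
    intro a ha b hb
    have := Submodule.mul_mem_mul ha hb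
    rw [Submodule.span_mul_span] at this
    refine Submodule.span_mono ?_ this
    rintro _ ⟨_, ⟨I, rfl⟩, _, ⟨J, rfl⟩, rfl⟩
    exact ⟨I ++ J, SqWord_append I J⟩
  induction y using FreeAlgebra.induction with
  | grade0 r =>
    rw [AlgHom.commutes, Algebra.algebraMap_eq_smul_one]
    exact Submodule.smul_mem _ _ (Submodule.subset_span ⟨[], rfl⟩)
  | grade1 n =>
    refine Submodule.subset_span ⟨[(n : ℕ)], ?_⟩
    rw [SqWord_singleton, Sq, S_coe]
  | mul a b ha hb => rw [map_mul]; exact hmul _ ha _ hb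
  | add a b ha hb => rw [map_add]; exact Submodule.add_mem _ ha hb

end Algebras

section Antipode
open Finset.HasAntidiagonal (antidiagonal)
open scoped TensorProduct
open PowerSeries (coeff_mk coeff_mul coeff_C_mul coeff_mul_C)

/-- The power series `∑ v i j x ^ i y ^ j`. -/
noncomputable def doubleSeries {B : Type*} (v : ℕ → ℕ → B) : PowerSeries (PowerSeries B) :=
  PowerSeries.mk fun j => PowerSeries.mk fun i => v i j

theorem doubleSeries_injective {B : Type*} [Ring B] :
    Function.Injective (doubleSeries (B := B)) := by
  intro u v h
  funext i j
  have := congrArg (fun f => PowerSeries.coeff i (PowerSeries.coeff j f)) h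
  simpa [doubleSeries] using this

theorem doubleSeries_convolve {B : Type*} [Ring B] [Algebra (ZMod 2) B] (u v : ℕ → ℕ → B) :
    doubleSeries (convolve (LinearMap.mul (ZMod 2) B) u v) =
      doubleSeries u * doubleSeries v := by
  ext j i
  simp [doubleSeries, convolve, coeff_mul]

/-- The family with `1` at `(0, 0)`. -/
def unitFamily {B : Type*} [Zero B] [One B] (i j : ℕ) : B := if i = 0 ∧ j = 0 then 1 else 0

theorem doubleSeries_unitFamily {B : Type*} [Ring B] :
    doubleSeries (unitFamily (B := B)) = 1 := by
  ext j i
  simp only [doubleSeries, unitFamily, coeff_mk, PowerSeries.coeff_one]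
  by_cases hj : j = 0 <;> by_cases hi : i = 0 <;> simp [hi, hj, PowerSeries.coeff_one]

theorem expand_unitFamily {B : Type*} [Ring B] [Algebra (ZMod 2) B] :
    expand (unitFamily (B := B)) = unitFamily := by
  funext i j
  rw [expand, Finset.sum_eq_single 0, Finset.sum_eq_single 0]
  · simp [unitFamily, kappa_zero_zero]
  · intro b _ hb; simp [unitFamily, hb]
  · simp
  · intro a _ ha; simp [unitFamily, ha]
  · simp

/-- The total square `∑ Sqⁿ xⁿ`. -/
noncomputable def totalSq : PowerSeries SteenrodAlgebra := PowerSeries.mk Sq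

/-- The inverse of the total square. -/
noncomputable def totalSqInv : PowerSeries SteenrodAlgebra := PowerSeries.invOfUnit totalSq 1

theorem totalSq_mul_inv : totalSq * totalSqInv = 1 :=
  PowerSeries.mul_invOfUnit _ _ (by simp [totalSq, Sq_zero])

theorem totalSqInv_mul : totalSqInv * totalSq = 1 :=
  PowerSeries.invOfUnit_mul _ _ (by simp [totalSq, Sq_zero])

/-- The conjugate squares `χ(Sqⁿ)`. -/
noncomputable def conjSq (n : ℕ) : SteenrodAlgebra := PowerSeries.coeff n totalSqInv

theorem conjSq_zero : conjSq 0 = 1 := by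
  simp [conjSq, totalSqInv]

theorem sum_Sq_mul_conjSq (n : ℕ) :
    ∑ p ∈ antidiagonal n, Sq p.1 * conjSq p.2 = if n = 0 then 1 else 0 := by
  have := congrArg (PowerSeries.coeff n) totalSq_mul_inv
  rw [coeff_mul, PowerSeries.coeff_one] at this
  rw [← this]
  simp [conjSq, totalSq]

theorem sum_conjSq_mul_Sq (n : ℕ) :
    ∑ p ∈ antidiagonal n, conjSq p.1 * Sq p.2 = if n = 0 then 1 else 0 := by
  have := congrArg (PowerSeries.coeff n) totalSqInv_mul
  rw [coeff_mul, PowerSeries.coeff_one] at this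
  rw [← this]
  simp [conjSq, totalSq]

theorem exists_left_inverse {B : Type*} [Ring B] (m : ℕ → ℕ → B) (h : m 0 0 = 1) :
    ∃ m' : ℕ → ℕ → B, doubleSeries m' * doubleSeries m = 1 := by
  let f : PowerSeries B := PowerSeries.mk fun i => m i 0
  have hf : PowerSeries.constantCoeff f = ((1 : Bˣ) : B) := by simp [f, h]
  let u : (PowerSeries B)ˣ := ⟨f, PowerSeries.invOfUnit f 1, PowerSeries.mul_invOfUnit _ _ hf,
    PowerSeries.invOfUnit_mul _ _ hf⟩
  refine ⟨fun i j => PowerSeries.coeff i (PowerSeries.coeff j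
    (PowerSeries.invOfUnit (doubleSeries m) u)), ?_⟩
  have : doubleSeries (fun i j => PowerSeries.coeff i (PowerSeries.coeff j
    (PowerSeries.invOfUnit (doubleSeries m) u))) = PowerSeries.invOfUnit (doubleSeries m) u := by
    ext j i; simp [doubleSeries]
  rw [this]
  exact PowerSeries.invOfUnit_mul _ _ (by simp [doubleSeries, u, f])

theorem ademRelations_conjSq : AdemRelations fun i j => conjSq j * conjSq i := by
  obtain ⟨m, hm⟩ := exists_expand_Sq
  have hm0 : m 0 0 = 1 := by
    have := congrFun (congrFun hm 0) 0
    simpa [Sq_zero, expand, kappa_zero_zero] using this.symm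
  obtain ⟨m', hm'⟩ := exists_left_inverse m hm0
  have h1 : doubleSeries (expand m') * doubleSeries (fun i j => Sq i * Sq j) = 1 := by
    rw [hm, ← doubleSeries_convolve, convolve_expand, ← doubleSeries_unitFamily,
      ← expand_unitFamily]
    congr 2
    apply doubleSeries_injective
    rw [doubleSeries_convolve, hm', doubleSeries_unitFamily]
  have h2 : doubleSeries (fun i j => Sq i * Sq j) *
      doubleSeries (fun i j => conjSq j * conjSq i) = 1 := by
    have e1 : doubleSeries (fun i j => Sq i * Sq j) =
        PowerSeries.C totalSq * PowerSeries.map (PowerSeries.C) totalSq := by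
      ext j i; simp [doubleSeries, totalSq]
    have e2 : doubleSeries (fun i j => conjSq j * conjSq i) =
        PowerSeries.map (PowerSeries.C) totalSqInv * PowerSeries.C totalSqInv := by
      ext j i; simp [doubleSeries, conjSq]
    rw [e1, e2, mul_assoc, ← mul_assoc (PowerSeries.map _ _), ← map_mul, totalSq_mul_inv, map_one,
      one_mul, ← map_mul, totalSq_mul_inv, map_one]
  have h3 : expand m' = fun i j => conjSq j * conjSq i := by
    apply doubleSeries_injective
    calc _ = doubleSeries (expand m') * (doubleSeries (fun i j => Sq i * Sq j) *
          doubleSeries (fun i j => conjSq j * conjSq i)) := by rw [h2, mul_one]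
      _ = _ := by rw [← mul_assoc, h1, one_mul]
  rw [← h3]
  exact ademRelations_expand m'

/-- The antipode of the Steenrod algebra as an algebra map to the opposite algebra. -/
noncomputable def antipodeOp : SteenrodAlgebra →ₐ[ZMod 2] SteenrodAlgebraᵐᵒᵖ :=
  liftAdem (FreeAlgebra.lift (ZMod 2) fun n : ℕ+ => MulOpposite.op (conjSq n)) (by
    intro i j hi hij
    have := congrArg MulOpposite.op (ademRelations_conjSq i j hi hij)
    simp only [lift_S (fun n => MulOpposite.op (conjSq n)) (by rw [conjSq_zero]; rfl)]
    simpa using this)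

theorem antipodeOp_Sq (n : ℕ) : antipodeOp (Sq n) = MulOpposite.op (conjSq n) :=
  (liftAdem_proj _ _ _).trans
    (lift_S (fun n => MulOpposite.op (conjSq n)) (by rw [conjSq_zero]; rfl) n)

/-- The antipode of the Steenrod algebra. -/
noncomputable def antipodeAux : SteenrodAlgebra →ₗ[ZMod 2] SteenrodAlgebra :=
  (MulOpposite.opLinearEquiv (ZMod 2)).symm.toLinearMap ∘ₗ antipodeOp.toLinearMap

theorem antipodeAux_Sq (n : ℕ) : antipodeAux (Sq n) = conjSq n := by
  simp [antipodeAux, antipodeOp_Sq]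

theorem antipodeAux_mul (x y : SteenrodAlgebra) :
    antipodeAux (x * y) = antipodeAux y * antipodeAux x := by
  simp [antipodeAux]

theorem antipodeAux_one : antipodeAux 1 = 1 := by
  simp [antipodeAux]

theorem linearMap_ext_SqWord {E : Type*} [AddCommGroup E] [Module (ZMod 2) E]
    {f g : SteenrodAlgebra →ₗ[ZMod 2] E} (h : ∀ I, f (SqWord I) = g (SqWord I)) : f = g :=
  LinearMap.ext_on_range span_SqWord h

noncomputable instance : HopfAlgebra (ZMod 2) SteenrodAlgebra where
  antipode := antipodeAux
  mul_antipode_rTensor_comul := by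
    refine linearMap_ext_SqWord fun I => ?_
    have key : ∀ (n : ℕ) (z : SteenrodAlgebra ⊗[ZMod 2] SteenrodAlgebra),
        LinearMap.mul' (ZMod 2) SteenrodAlgebra (antipodeAux.rTensor SteenrodAlgebra
          (Coalgebra.comul (R := ZMod 2) (Sq n) * z)) = (if n = 0 then (1 : SteenrodAlgebra) else 0) *
        LinearMap.mul' (ZMod 2) SteenrodAlgebra (antipodeAux.rTensor SteenrodAlgebra z) := by
      intro n z
      induction z using TensorProduct.induction_on with
      | zero => simp
      | add x y hx hy => simp only [mul_add, map_add, hx, hy]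
      | tmul x y =>
        rw [comul_Sq, Finset.sum_mul, map_sum, map_sum, ← sum_conjSq_mul_Sq n]
        simp only [Algebra.TensorProduct.tmul_mul_tmul, LinearMap.rTensor_tmul,
          LinearMap.mul'_apply, antipodeAux_mul, antipodeAux_Sq]
        have : ∀ p ∈ antidiagonal n, antipodeAux x * conjSq p.1 * (Sq p.2 * y) =
            antipodeAux x * (conjSq p.1 * Sq p.2) * y := by
          intro p _; simp only [mul_assoc]
        rw [Finset.sum_congr rfl this, ← Finset.sum_mul, ← Finset.mul_sum, sum_conjSq_mul_Sq]
        split_ifs <;> simp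
    induction I with
    | nil =>
      simp [SqWord_nil, Algebra.TensorProduct.one_def, antipodeAux_one]
    | cons n I ih =>
      simp only [LinearMap.comp_apply] at ih ⊢
      rw [SqWord_cons, Bialgebra.comul_mul, key, ih, Bialgebra.counit_mul, counit_Sq]
      split_ifs <;> simp
  mul_antipode_lTensor_comul := by
    refine linearMap_ext_SqWord fun I => ?_
    have key : ∀ (n : ℕ) (z : SteenrodAlgebra ⊗[ZMod 2] SteenrodAlgebra),
        LinearMap.mul' (ZMod 2) SteenrodAlgebra (antipodeAux.lTensor SteenrodAlgebra
          (z * Coalgebra.comul (R := ZMod 2) (Sq n))) = (if n = 0 then (1 : SteenrodAlgebra) else 0) *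
        LinearMap.mul' (ZMod 2) SteenrodAlgebra (antipodeAux.lTensor SteenrodAlgebra z) := by
      intro n z
      induction z using TensorProduct.induction_on with
      | zero => simp
      | add x y hx hy => simp only [mul_add, add_mul, map_add, hx, hy]
      | tmul x y =>
        rw [comul_Sq, Finset.mul_sum, map_sum, map_sum, ← sum_Sq_mul_conjSq n]
        simp only [Algebra.TensorProduct.tmul_mul_tmul, LinearMap.lTensor_tmul,
          LinearMap.mul'_apply, antipodeAux_mul, antipodeAux_Sq]
        have : ∀ p ∈ antidiagonal n, x * Sq p.1 * (conjSq p.2 * antipodeAux y) =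
            x * (Sq p.1 * conjSq p.2) * antipodeAux y := by
          intro p _; simp only [mul_assoc]
        rw [Finset.sum_congr rfl this, ← Finset.sum_mul, ← Finset.mul_sum, sum_Sq_mul_conjSq]
        split_ifs <;> simp
    induction I using List.reverseRecOn with
    | nil =>
      simp [SqWord_nil, Algebra.TensorProduct.one_def, antipodeAux_one]
    | append_singleton I n ih =>
      simp only [LinearMap.comp_apply] at ih ⊢
      rw [SqWord_append, SqWord_singleton, Bialgebra.comul_mul, key, ih, Bialgebra.counit_mul,
        counit_Sq]
      split_ifs <;> simp

end Antipode

section Dual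
open Finset.HasAntidiagonal (antidiagonal)
open scoped TensorProduct

/-- The degree `d` part of the Steenrod algebra, `Sqⁿ` having degree `n`. -/
noncomputable def degreePart (d : ℕ) : Submodule (ZMod 2) SteenrodAlgebra :=
  Submodule.span (ZMod 2) {x | ∃ I : List ℕ, I.sum = d ∧ SqWord I = x}

theorem SqWord_mem_degreePart (I : List ℕ) : SqWord I ∈ degreePart I.sum :=
  Submodule.subset_span ⟨I, rfl, rfl⟩

theorem forall_degreePart_iff {E : Type*} [AddCommGroup E] [Module (ZMod 2) E]
    (f : SteenrodAlgebra →ₗ[ZMod 2] E) (N : ℕ) :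
    (∀ d, N < d → ∀ x ∈ degreePart d, f x = 0) ↔ ∀ I : List ℕ, N < I.sum → f (SqWord I) = 0 := by
  constructor
  · intro h I hI
    exact h _ hI _ (SqWord_mem_degreePart I)
  · intro h d hd x hx
    have : degreePart d ≤ LinearMap.ker f := by
      rw [degreePart, Submodule.span_le]
      rintro _ ⟨I, rfl, rfl⟩
      exact h I hd
    exact this hx

theorem comul_SqWord_mem (I : List ℕ) : Coalgebra.comul (R := ZMod 2) (SqWord I) ∈
    Submodule.span (ZMod 2) {z : SteenrodAlgebra ⊗[ZMod 2] SteenrodAlgebra |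
      ∃ J K : List ℕ, J.sum + K.sum = I.sum ∧ SqWord J ⊗ₜ[ZMod 2] SqWord K = z} := by
  induction I with
  | nil =>
    rw [SqWord_nil, Bialgebra.comul_one]
    exact Submodule.subset_span ⟨[], [], rfl, rfl⟩
  | cons n I ih =>
    rw [SqWord_cons, Bialgebra.comul_mul, comul_Sq, Finset.sum_mul]
    refine Submodule.sum_mem _ fun p hp => ?_
    rw [Finset.HasAntidiagonal.mem_antidiagonal] at hp
    generalize Coalgebra.comul (R := ZMod 2) (SqWord I) = z at ih ⊢
    induction ih using Submodule.span_induction with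
    | zero => simp
    | add x y _ _ hx hy => rw [mul_add]; exact Submodule.add_mem _ hx hy
    | smul c x _ hx => rw [mul_smul_comm]; exact Submodule.smul_mem _ _ hx
    | mem x hx =>
      obtain ⟨J, K, h, rfl⟩ := hx
      refine Submodule.subset_span ⟨p.1 :: J, p.2 :: K, ?_, ?_⟩
      · simp only [List.sum_cons]; omega
      · rw [Algebra.TensorProduct.tmul_mul_tmul, SqWord_cons, SqWord_cons]

theorem counit_SqWord (I : List ℕ) (h : 0 < I.sum) :
    Coalgebra.counit (R := ZMod 2) (SqWord I) = 0 := by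
  induction I with
  | nil => simp at h
  | cons n I ih =>
    rw [SqWord_cons, Bialgebra.counit_mul, counit_Sq]
    split_ifs with hn
    · rw [ih (by simpa [hn] using h), mul_zero]
    · rw [zero_mul]

/-- The graded dual of the Steenrod algebra inside the convolution algebra of all linear forms:
the linear forms that vanish in all sufficiently large degrees. The product of linear forms is
dual to the coproduct of the Steenrod algebra. -/
noncomputable def dualSubalgebra :
    Subalgebra (ZMod 2) (WithConv (SteenrodAlgebra →ₗ[ZMod 2] ZMod 2)) where
  carrier := {f | ∃ N : ℕ, ∀ d, N < d → ∀ x ∈ degreePart d, f x = 0}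
  mul_mem' := by
    rintro f g ⟨N, hf⟩ ⟨M, hg⟩
    rw [forall_degreePart_iff] at hf hg
    refine ⟨N + M, (forall_degreePart_iff _ _).2 fun I hI => ?_⟩
    have := comul_SqWord_mem I
    change LinearMap.mul' _ _ (TensorProduct.map f.ofConv g.ofConv (Coalgebra.comul _)) = 0
    generalize Coalgebra.comul (R := ZMod 2) (SqWord I) = z at this ⊢
    induction this using Submodule.span_induction with
    | zero => simp
    | add x y _ _ hx hy => rw [map_add, map_add, hx, hy, add_zero]
    | smul c x _ hx => rw [map_smul, map_smul, hx, smul_zero]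
    | mem x hx =>
      obtain ⟨J, K, h, rfl⟩ := hx
      rw [TensorProduct.map_tmul, LinearMap.mul'_apply]
      rcases lt_or_ge N J.sum with hJ | hJ
      · rw [hf J hJ, zero_mul]
      · rw [hg K (by omega), mul_zero]
  add_mem' := by
    rintro f g ⟨N, hf⟩ ⟨M, hg⟩
    refine ⟨N + M, fun d hd x hx => ?_⟩
    change f x + g x = 0
    rw [hf d (by omega) x hx, hg d (by omega) x hx, add_zero]
  algebraMap_mem' r := by
    refine ⟨0, (forall_degreePart_iff _ _).2 fun I hI => ?_⟩
    change (algebraMap (ZMod 2) (WithConv (SteenrodAlgebra →ₗ[ZMod 2] ZMod 2)) r) (SqWord I) = 0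
    rw [LinearMap.convAlgebraMap_apply, counit_SqWord I hI, map_zero, smul_zero]

/-- The mod 2 dual Steenrod algebra: the graded dual of the Steenrod algebra. -/
def DualSteenrodAlgebra : Type := dualSubalgebra

noncomputable instance : CommRing DualSteenrodAlgebra :=
  inferInstanceAs (CommRing dualSubalgebra)

noncomputable instance : Algebra (ZMod 2) DualSteenrodAlgebra :=
  inferInstanceAs (Algebra (ZMod 2) dualSubalgebra)

/-- The linear form on the Steenrod algebra that an element of its graded dual is. -/
noncomputable def toForm : DualSteenrodAlgebra →ₗ[ZMod 2] Module.Dual (ZMod 2) SteenrodAlgebra :=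
  (WithConv.linearEquiv (ZMod 2) (SteenrodAlgebra →ₗ[ZMod 2] ZMod 2)).toLinearMap ∘ₗ
    dualSubalgebra.val.toLinearMap

theorem toForm_injective : Function.Injective toForm := by
  intro f g h
  exact Subtype.ext (WithConv.ofConv_injective h)

/-- A linear form that vanishes on all monomials of large degree, as an element of the dual. -/
noncomputable def ofForm (f : Module.Dual (ZMod 2) SteenrodAlgebra)
    (hf : ∃ N : ℕ, ∀ I : List ℕ, N < I.sum → f (SqWord I) = 0) : DualSteenrodAlgebra :=
  ⟨WithConv.toConv f, hf.imp fun N h => (forall_degreePart_iff f N).2 h⟩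

theorem toForm_ofForm (f : Module.Dual (ZMod 2) SteenrodAlgebra)
    (hf : ∃ N : ℕ, ∀ I : List ℕ, N < I.sum → f (SqWord I) = 0) : toForm (ofForm f hf) = f := rfl

theorem exists_bound (f : DualSteenrodAlgebra) :
    ∃ N : ℕ, ∀ I : List ℕ, N < I.sum → toForm f (SqWord I) = 0 :=
  f.2.imp fun N h => (forall_degreePart_iff (toForm f) N).1 h

theorem toForm_one (x : SteenrodAlgebra) : toForm 1 x = Coalgebra.counit (R := ZMod 2) x := rfl

theorem toForm_algebraMap (r : ZMod 2) (x : SteenrodAlgebra) :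
    toForm (algebraMap (ZMod 2) DualSteenrodAlgebra r) x =
      r * Coalgebra.counit (R := ZMod 2) x := by
  rw [Algebra.algebraMap_eq_smul_one, map_smul]; rfl

theorem toForm_mul (f g : DualSteenrodAlgebra) (x : SteenrodAlgebra) :
    toForm (f * g) x = TensorProduct.dualDistrib (ZMod 2) SteenrodAlgebra SteenrodAlgebra
      (toForm f ⊗ₜ toForm g) (Coalgebra.comul (R := ZMod 2) x) := by
  change LinearMap.mul' _ _ (TensorProduct.map (toForm f) (toForm g)
    (Coalgebra.comul (R := ZMod 2) x)) = _
  induction Coalgebra.comul (R := ZMod 2) x using TensorProduct.induction_on with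
  | zero => simp
  | add x y hx hy => rw [map_add, map_add, map_add, hx, hy]
  | tmul x y => simp

/-- For pairings `X → V*` and `Y → W*`, the pairing `X ⊗ Y → (V ⊗ W)*`. -/
noncomputable def pairing {X Y V W : Type*} [AddCommGroup X] [Module (ZMod 2) X] [AddCommGroup Y]
    [Module (ZMod 2) Y] [AddCommGroup V] [Module (ZMod 2) V] [AddCommGroup W] [Module (ZMod 2) W]
    (f : X →ₗ[ZMod 2] Module.Dual (ZMod 2) V) (g : Y →ₗ[ZMod 2] Module.Dual (ZMod 2) W) :
    X ⊗[ZMod 2] Y →ₗ[ZMod 2] Module.Dual (ZMod 2) (V ⊗[ZMod 2] W) :=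
  TensorProduct.dualDistrib (ZMod 2) V W ∘ₗ TensorProduct.map f g

theorem pairing_tmul {X Y V W : Type*} [AddCommGroup X] [Module (ZMod 2) X] [AddCommGroup Y]
    [Module (ZMod 2) Y] [AddCommGroup V] [Module (ZMod 2) V] [AddCommGroup W] [Module (ZMod 2) W]
    (f : X →ₗ[ZMod 2] Module.Dual (ZMod 2) V) (g : Y →ₗ[ZMod 2] Module.Dual (ZMod 2) W)
    (x : X) (y : Y) (v : V) (w : W) : pairing f g (x ⊗ₜ y) (v ⊗ₜ w) = f x v * g y w := by
  simp [pairing]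

theorem pairing_injective {X Y V W : Type*} [AddCommGroup X] [Module (ZMod 2) X] [AddCommGroup Y]
    [Module (ZMod 2) Y] [AddCommGroup V] [Module (ZMod 2) V] [AddCommGroup W] [Module (ZMod 2) W]
    (f : X →ₗ[ZMod 2] Module.Dual (ZMod 2) V) (g : Y →ₗ[ZMod 2] Module.Dual (ZMod 2) W)
    (hf : Function.Injective f) (hg : Function.Injective g) :
    Function.Injective (pairing f g) := by
  classical
  rw [injective_iff_map_eq_zero]
  intro z hz
  let b := Module.Basis.ofVectorSpace (ZMod 2) X
  obtain ⟨c, rfl⟩ := TensorProduct.eq_repr_basis_left b z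
  have hc : c = 0 := by
    ext i
    apply hg
    rw [Finsupp.zero_apply, map_zero]
    ext w
    have h1 : f (c.sum fun i y => g y w • b i) = 0 := by
      ext v
      have := LinearMap.congr_fun hz (v ⊗ₜ w)
      simp only [Finsupp.sum, map_sum, LinearMap.sum_apply, pairing_tmul, LinearMap.zero_apply]
        at this
      simp only [Finsupp.sum, map_sum, LinearMap.sum_apply, map_smul, LinearMap.smul_apply,
        LinearMap.zero_apply, smul_eq_mul]
      rw [← this]
      exact Finset.sum_congr rfl fun _ _ => mul_comm _ _
    have h2 := hf (h1.trans (map_zero f).symm)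
    have h3 := congrArg (fun x => b.repr x i) h2
    simp only [Finsupp.sum, map_sum, map_smul, Module.Basis.repr_self, Finsupp.smul_single,
      smul_eq_mul, mul_one, map_zero, Finsupp.coe_zero, Pi.zero_apply, Finsupp.finsetSum_apply,
      Finsupp.single_apply] at h3
    rw [Finset.sum_ite_eq'] at h3
    split_ifs at h3 with hi
    · simpa using h3
    · simp only [Finsupp.mem_support_iff, not_not] at hi
      simp [hi]
  rw [hc, Finsupp.sum_zero_index]

/-- The pairing of `A* ⊗ A*` with `A ⊗ A`. -/
noncomputable def pair₂ : DualSteenrodAlgebra ⊗[ZMod 2] DualSteenrodAlgebra →ₗ[ZMod 2]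
    Module.Dual (ZMod 2) (SteenrodAlgebra ⊗[ZMod 2] SteenrodAlgebra) := pairing toForm toForm

theorem pair₂_injective : Function.Injective pair₂ :=
  pairing_injective _ _ toForm_injective toForm_injective

theorem SqWord_filter (I : List ℕ) : SqWord (I.filter (0 < ·)) = SqWord I := by
  induction I with
  | nil => rfl
  | cons n I ih =>
    by_cases h : 0 < n
    · rw [List.filter_cons_of_pos (by simpa using h), SqWord_cons, SqWord_cons, ih]
    · rw [List.filter_cons_of_neg (by simpa using h), ih, SqWord_cons, Nat.eq_zero_of_not_pos h,
        Sq_zero, one_mul]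

theorem sum_filter_pos (I : List ℕ) : (I.filter (0 < ·)).sum = I.sum := by
  induction I with
  | nil => rfl
  | cons n I ih =>
    by_cases h : 0 < n
    · rw [List.filter_cons_of_pos (by simpa using h), List.sum_cons, List.sum_cons, ih]
    · rw [List.filter_cons_of_neg (by simpa using h), ih, List.sum_cons]; omega

theorem finite_SqWord (N : ℕ) : {x | ∃ I : List ℕ, I.sum ≤ N ∧ SqWord I = x}.Finite := by
  refine (Set.finite_range (fun x : (d : Fin (N + 1)) × Composition d => SqWord x.2.blocks)).subset ?_
  rintro _ ⟨I, hI, rfl⟩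
  refine ⟨⟨⟨I.sum, by omega⟩, ⟨I.filter (0 < ·), ?_, sum_filter_pos I⟩⟩, SqWord_filter I⟩
  intro i hi
  simpa using (List.mem_filter.1 hi).2

/-- The linear form `x ↦ ⟨f, a x⟩`. -/
noncomputable def translate (f : DualSteenrodAlgebra) : SteenrodAlgebra →ₗ[ZMod 2] DualSteenrodAlgebra where
  toFun a := ofForm (toForm f ∘ₗ LinearMap.mulLeft (ZMod 2) a) (by
    obtain ⟨N, hN⟩ := exists_bound f
    refine ⟨N, fun I hI => ?_⟩
    have : toForm f ∘ₗ LinearMap.mulRight (ZMod 2) (SqWord I) = 0 := by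
      refine linearMap_ext_SqWord fun J => ?_
      simp only [LinearMap.comp_apply, LinearMap.mulRight_apply, LinearMap.zero_apply]
      rw [← SqWord_append]
      exact hN _ (by rw [List.sum_append]; omega)
    exact LinearMap.congr_fun this a)
  map_add' a b := by
    apply toForm_injective
    rw [map_add]
    ext x
    simp [toForm_ofForm, add_mul]
  map_smul' c a := by
    apply toForm_injective
    rw [map_smul]
    ext x
    simp [toForm_ofForm]

theorem toForm_translate (f : DualSteenrodAlgebra) (a x : SteenrodAlgebra) :
    toForm (translate f a) x = toForm f (a * x) := rfl

theorem exists_coproduct (f : DualSteenrodAlgebra) :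
    toForm f ∘ₗ LinearMap.mul' (ZMod 2) SteenrodAlgebra ∈ LinearMap.range pair₂ := by
  obtain ⟨N, hN⟩ := exists_bound f
  have hz : ∀ I : List ℕ, N < I.sum → translate f (SqWord I) = 0 := by
    intro I hI
    apply toForm_injective
    rw [map_zero]
    refine linearMap_ext_SqWord fun J => ?_
    rw [toForm_translate, ← SqWord_append, LinearMap.zero_apply]
    exact hN _ (by rw [List.sum_append]; omega)
  have hfin : Module.Finite (ZMod 2) (LinearMap.range (translate f)) := by
    rw [Module.Finite.iff_fg, Submodule.fg_def]
    refine ⟨_, (finite_SqWord N).image (translate f), le_antisymm ?_ ?_⟩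
    · rw [Submodule.span_le]
      rintro _ ⟨x, _, rfl⟩
      exact ⟨x, rfl⟩
    · rw [LinearMap.range_eq_map, ← span_SqWord, Submodule.map_span, Submodule.span_le]
      rintro _ ⟨_, ⟨I, rfl⟩, rfl⟩
      rcases lt_or_ge N I.sum with h | h
      · rw [hz I h]; exact Submodule.zero_mem _
      · exact Submodule.subset_span ⟨_, ⟨I, h, rfl⟩, rfl⟩
  let b := Module.finBasis (ZMod 2) (LinearMap.range (translate f))
  let c : Fin _ → DualSteenrodAlgebra := fun i =>
    ofForm (b.coord i ∘ₗ (translate f).rangeRestrict) ⟨N, fun I hI => by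
      have : (translate f).rangeRestrict (SqWord I) = 0 := Subtype.ext (hz I hI)
      rw [LinearMap.comp_apply, this, map_zero]⟩
  refine ⟨∑ i, c i ⊗ₜ (b i : DualSteenrodAlgebra), ?_⟩
  refine TensorProduct.ext' fun x y => ?_
  rw [map_sum, LinearMap.sum_apply]
  simp only [pair₂, pairing_tmul, LinearMap.comp_apply, LinearMap.mul'_apply]
  rw [← toForm_translate]
  have h := congrArg Subtype.val (b.sum_repr ((translate f).rangeRestrict x))
  rw [LinearMap.codRestrict_apply] at h
  rw [← h, Submodule.coe_sum, map_sum, LinearMap.sum_apply]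
  refine Finset.sum_congr rfl fun i _ => ?_
  simp [c, toForm_ofForm]

/-- The coproduct of the dual Steenrod algebra, dual to the product of the Steenrod algebra. -/
noncomputable def dualComul :
    DualSteenrodAlgebra →ₗ[ZMod 2] DualSteenrodAlgebra ⊗[ZMod 2] DualSteenrodAlgebra :=
  (LinearEquiv.ofInjective pair₂ pair₂_injective).symm.toLinearMap ∘ₗ
    LinearMap.codRestrict (LinearMap.range pair₂)
      ((LinearMap.mul' (ZMod 2) SteenrodAlgebra).dualMap ∘ₗ toForm) exists_coproduct

/-- The coproduct of `f` is the element `∑ f' ⊗ f''` with `⟨f, x y⟩ = ∑ ⟨f', x⟩ ⟨f'', y⟩`. -/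
theorem pair₂_dualComul (f : DualSteenrodAlgebra) (w : SteenrodAlgebra ⊗[ZMod 2] SteenrodAlgebra) :
    pair₂ (dualComul f) w = toForm f (LinearMap.mul' (ZMod 2) SteenrodAlgebra w) := by
  have := (LinearEquiv.ofInjective pair₂ pair₂_injective).apply_symm_apply
    (LinearMap.codRestrict (LinearMap.range pair₂)
      ((LinearMap.mul' (ZMod 2) SteenrodAlgebra).dualMap ∘ₗ toForm) exists_coproduct f)
  exact LinearMap.congr_fun (congrArg Subtype.val this) w

/-- The counit of the dual Steenrod algebra: evaluation at `1`. -/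
noncomputable def dualCounit : DualSteenrodAlgebra →ₗ[ZMod 2] ZMod 2 :=
  LinearMap.applyₗ (1 : SteenrodAlgebra) ∘ₗ toForm

theorem dualCounit_apply (f : DualSteenrodAlgebra) : dualCounit f = toForm f 1 := rfl

theorem toForm_lid_counit (z : DualSteenrodAlgebra ⊗[ZMod 2] DualSteenrodAlgebra)
    (x : SteenrodAlgebra) : toForm (TensorProduct.lid (ZMod 2) DualSteenrodAlgebra
      (dualCounit.rTensor DualSteenrodAlgebra z)) x = pair₂ z (1 ⊗ₜ x) := by
  induction z using TensorProduct.induction_on with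
  | zero => simp
  | add y z hy hz => simp only [map_add, LinearMap.add_apply, hy, hz]
  | tmul f g => simp [pair₂, pairing_tmul, dualCounit_apply]

theorem toForm_rid_counit (z : DualSteenrodAlgebra ⊗[ZMod 2] DualSteenrodAlgebra)
    (x : SteenrodAlgebra) : toForm (TensorProduct.rid (ZMod 2) DualSteenrodAlgebra
      (dualCounit.lTensor DualSteenrodAlgebra z)) x = pair₂ z (x ⊗ₜ 1) := by
  induction z using TensorProduct.induction_on with
  | zero => simp
  | add y z hy hz => simp only [map_add, LinearMap.add_apply, hy, hz]
  | tmul f g => simp [pair₂, pairing_tmul, dualCounit_apply, mul_comm]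

theorem pairing_lTensor (z : DualSteenrodAlgebra ⊗[ZMod 2] DualSteenrodAlgebra)
    (x y w : SteenrodAlgebra) :
    pairing toForm pair₂ (dualComul.lTensor DualSteenrodAlgebra z) (x ⊗ₜ (y ⊗ₜ w)) =
      pair₂ z (x ⊗ₜ (y * w)) := by
  induction z using TensorProduct.induction_on with
  | zero => simp
  | add u v hu hv => simp only [map_add, LinearMap.add_apply, hu, hv]
  | tmul f g => simp [pair₂_dualComul, pairing_tmul, pair₂.eq_def ▸ pairing_tmul toForm toForm f g]

theorem pairing_assoc (z : DualSteenrodAlgebra ⊗[ZMod 2] DualSteenrodAlgebra)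
    (g : DualSteenrodAlgebra) (x y w : SteenrodAlgebra) :
    pairing toForm pair₂ (TensorProduct.assoc (ZMod 2) _ _ _ (z ⊗ₜ g)) (x ⊗ₜ (y ⊗ₜ w)) =
      pair₂ z (x ⊗ₜ y) * toForm g w := by
  induction z using TensorProduct.induction_on with
  | zero => simp
  | add u v hu hv => simp only [TensorProduct.add_tmul, map_add, LinearMap.add_apply, hu, hv, add_mul]
  | tmul f f' => simp [pair₂, pairing_tmul, mul_assoc]

theorem pairing_rTensor (z : DualSteenrodAlgebra ⊗[ZMod 2] DualSteenrodAlgebra)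
    (x y w : SteenrodAlgebra) :
    pairing toForm pair₂ (TensorProduct.assoc (ZMod 2) _ _ _
      (dualComul.rTensor DualSteenrodAlgebra z)) (x ⊗ₜ (y ⊗ₜ w)) =
      pair₂ z ((x * y) ⊗ₜ w) := by
  induction z using TensorProduct.induction_on with
  | zero => simp
  | add u v hu hv => simp only [map_add, LinearMap.add_apply, hu, hv]
  | tmul f g =>
    rw [LinearMap.rTensor_tmul, pairing_assoc, pair₂_dualComul]
    simp [pair₂, pairing_tmul]

noncomputable instance : Coalgebra (ZMod 2) DualSteenrodAlgebra where
  comul := dualComul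
  counit := dualCounit
  coassoc := by
    ext f
    apply pairing_injective _ _ toForm_injective pair₂_injective
    refine TensorProduct.ext' fun x w => ?_
    induction w using TensorProduct.induction_on with
    | zero => simp
    | add u v hu hv => simp only [TensorProduct.tmul_add, map_add, hu, hv]
    | tmul y w =>
      simp only [LinearMap.comp_apply, LinearEquiv.coe_coe]
      rw [pairing_rTensor, pairing_lTensor, pair₂_dualComul, pair₂_dualComul]
      simp [mul_assoc]
  rTensor_counit_comp_comul := by
    ext f
    apply (TensorProduct.lid (ZMod 2) DualSteenrodAlgebra).injective
    apply toForm_injective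
    ext x
    rw [LinearMap.comp_apply, toForm_lid_counit, pair₂_dualComul]
    simp
  lTensor_counit_comp_comul := by
    ext f
    apply (TensorProduct.rid (ZMod 2) DualSteenrodAlgebra).injective
    apply toForm_injective
    ext x
    rw [LinearMap.comp_apply, toForm_rid_counit, pair₂_dualComul]
    simp

theorem pair₂_mul (z z' : DualSteenrodAlgebra ⊗[ZMod 2] DualSteenrodAlgebra)
    (x y : SteenrodAlgebra) : pair₂ (z * z') (x ⊗ₜ y) =
      pairing pair₂ pair₂ (z ⊗ₜ z') (TensorProduct.tensorTensorTensorComm (ZMod 2) _ _ _ _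
        (Coalgebra.comul (R := ZMod 2) x ⊗ₜ Coalgebra.comul (R := ZMod 2) y)) := by
  induction z using TensorProduct.induction_on with
  | zero => simp
  | add u v hu hv => simp only [add_mul, TensorProduct.add_tmul, map_add, LinearMap.add_apply, hu, hv]
  | tmul f g =>
  induction z' using TensorProduct.induction_on with
  | zero => simp
  | add u v hu hv => simp only [mul_add, TensorProduct.tmul_add, map_add, LinearMap.add_apply, hu, hv]
  | tmul f' g' =>
  rw [Algebra.TensorProduct.tmul_mul_tmul, pair₂, pairing_tmul, toForm_mul, toForm_mul]
  induction Coalgebra.comul (R := ZMod 2) x using TensorProduct.induction_on with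
  | zero => simp
  | add u v hu hv => simp only [TensorProduct.add_tmul, map_add, add_mul, hu, hv]
  | tmul x x' =>
  induction Coalgebra.comul (R := ZMod 2) y using TensorProduct.induction_on with
  | zero => simp
  | add u v hu hv => simp only [TensorProduct.tmul_add, map_add, mul_add, hu, hv]
  | tmul y y' =>
    simp only [TensorProduct.tensorTensorTensorComm_tmul, pairing_tmul,
      TensorProduct.dualDistrib_apply]
    ring

theorem mul'_tensorTensorTensorComm (u v : SteenrodAlgebra ⊗[ZMod 2] SteenrodAlgebra) :
    TensorProduct.map (LinearMap.mul' (ZMod 2) SteenrodAlgebra)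
      (LinearMap.mul' (ZMod 2) SteenrodAlgebra)
      (TensorProduct.tensorTensorTensorComm (ZMod 2) _ _ _ _ (u ⊗ₜ v)) = u * v := by
  induction u using TensorProduct.induction_on with
  | zero => simp
  | add a b ha hb => simp only [TensorProduct.add_tmul, map_add, add_mul, ha, hb]
  | tmul x x' =>
  induction v using TensorProduct.induction_on with
  | zero => simp
  | add a b ha hb => simp only [TensorProduct.tmul_add, map_add, mul_add, ha, hb]
  | tmul y y' => simp

theorem pairing_dualComul (f g : DualSteenrodAlgebra)
    (w : (SteenrodAlgebra ⊗[ZMod 2] SteenrodAlgebra) ⊗[ZMod 2]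
      (SteenrodAlgebra ⊗[ZMod 2] SteenrodAlgebra)) :
    pairing pair₂ pair₂ (dualComul f ⊗ₜ dualComul g) w = pair₂ (f ⊗ₜ g)
      (TensorProduct.map (LinearMap.mul' (ZMod 2) SteenrodAlgebra)
        (LinearMap.mul' (ZMod 2) SteenrodAlgebra) w) := by
  induction w using TensorProduct.induction_on with
  | zero => simp
  | add u v hu hv => simp only [map_add, hu, hv]
  | tmul u v =>
    rw [pairing_tmul, pair₂_dualComul, pair₂_dualComul, TensorProduct.map_tmul, pair₂, pairing_tmul]

noncomputable instance : Bialgebra (ZMod 2) DualSteenrodAlgebra :=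
  Bialgebra.mk' (ZMod 2) DualSteenrodAlgebra
    (by change toForm 1 1 = 1; rw [toForm_one, Bialgebra.counit_one])
    (by
      intro f g
      change toForm (f * g) 1 = toForm f 1 * toForm g 1
      rw [toForm_mul, Bialgebra.comul_one, Algebra.TensorProduct.one_def,
        TensorProduct.dualDistrib_apply])
    (by
      apply pair₂_injective
      refine TensorProduct.ext' fun x y => ?_
      refine (pair₂_dualComul 1 _).trans ?_
      rw [Algebra.TensorProduct.one_def, pair₂, pairing_tmul, toForm_one, toForm_one, toForm_one,
        LinearMap.mul'_apply, Bialgebra.counit_mul])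
    (by
      intro f g
      apply pair₂_injective
      refine TensorProduct.ext' fun x y => ?_
      refine (pair₂_dualComul (f * g) _).trans ?_
      change _ = pair₂ (dualComul f * dualComul g) _
      rw [pair₂_mul, pairing_dualComul, mul'_tensorTensorTensorComm, LinearMap.mul'_apply,
        toForm_mul, Bialgebra.comul_mul]
      rfl)

theorem mul_mem_degreePart {x y : SteenrodAlgebra} {d e : ℕ} (hx : x ∈ degreePart d)
    (hy : y ∈ degreePart e) : x * y ∈ degreePart (d + e) := by
  have := Submodule.mul_mem_mul hx hy
  rw [degreePart, degreePart, Submodule.span_mul_span] at this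
  refine Submodule.span_mono ?_ this
  rintro _ ⟨_, ⟨I, hI, rfl⟩, _, ⟨J, hJ, rfl⟩, rfl⟩
  exact ⟨I ++ J, by rw [List.sum_append, hI, hJ], SqWord_append I J⟩

theorem Sq_mem_degreePart (n : ℕ) : Sq n ∈ degreePart n := by
  simpa [SqWord_singleton] using SqWord_mem_degreePart [n]

theorem conjSq_mem_degreePart (n : ℕ) : conjSq n ∈ degreePart n := by
  induction n using Nat.strong_induction_on with
  | _ n ih =>
    rcases Nat.eq_zero_or_pos n with rfl | hn
    · rw [conjSq_zero]
      exact SqWord_mem_degreePart []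
    · have h := sum_Sq_mul_conjSq n
      rw [if_neg hn.ne', ← Finset.add_sum_erase _ _ (a := (0, n)) (by simp), Sq_zero, one_mul] at h
      rw [eq_neg_of_add_eq_zero_left h]
      refine Submodule.neg_mem _ (Submodule.sum_mem _ fun p hp => ?_)
      rw [Finset.mem_erase, Finset.HasAntidiagonal.mem_antidiagonal] at hp
      have h1 : p.1 ≠ 0 := by
        intro h0
        exact hp.1 (Prod.ext h0 (by have := hp.2; simp only; omega))
      rw [← hp.2]
      exact mul_mem_degreePart (Sq_mem_degreePart _) (ih _ (by omega))

theorem antipodeAux_SqWord_mem (I : List ℕ) : antipodeAux (SqWord I) ∈ degreePart I.sum := by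
  induction I with
  | nil => rw [SqWord_nil, antipodeAux_one]; exact SqWord_mem_degreePart []
  | cons n I ih =>
    rw [SqWord_cons, antipodeAux_mul, antipodeAux_Sq, List.sum_cons, add_comm]
    exact mul_mem_degreePart ih (conjSq_mem_degreePart n)

/-- The conjugation of the dual Steenrod algebra, the transpose of the antipode of the Steenrod
algebra. -/
noncomputable def dualAntipode : DualSteenrodAlgebra →ₗ[ZMod 2] DualSteenrodAlgebra where
  toFun f := ofForm (toForm f ∘ₗ antipodeAux) (by
    obtain ⟨N, hN⟩ := exists_bound f
    exact ⟨N, fun I hI => (forall_degreePart_iff _ _).2 hN _ hI _ (antipodeAux_SqWord_mem I)⟩)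
  map_add' f g := by
    refine toForm_injective (LinearMap.ext fun x => ?_)
    change toForm (f + g) (antipodeAux x) = toForm f (antipodeAux x) + toForm g (antipodeAux x)
    rw [map_add, LinearMap.add_apply]
  map_smul' c f := by
    refine toForm_injective (LinearMap.ext fun x => ?_)
    change toForm (c • f) (antipodeAux x) = c • toForm f (antipodeAux x)
    rw [map_smul, LinearMap.smul_apply]

theorem toForm_dualAntipode (f : DualSteenrodAlgebra) (x : SteenrodAlgebra) :
    toForm (dualAntipode f) x = toForm f (antipodeAux x) := rfl

theorem toForm_mul_rTensor (z : DualSteenrodAlgebra ⊗[ZMod 2] DualSteenrodAlgebra)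
    (x : SteenrodAlgebra) : toForm (LinearMap.mul' (ZMod 2) DualSteenrodAlgebra
      (dualAntipode.rTensor DualSteenrodAlgebra z)) x =
      pair₂ z (antipodeAux.rTensor SteenrodAlgebra (Coalgebra.comul (R := ZMod 2) x)) := by
  induction z using TensorProduct.induction_on with
  | zero => simp
  | add u v hu hv => simp only [map_add, LinearMap.add_apply, hu, hv]
  | tmul f g =>
    rw [LinearMap.rTensor_tmul, LinearMap.mul'_apply, toForm_mul]
    induction Coalgebra.comul (R := ZMod 2) x using TensorProduct.induction_on with
    | zero => simp
    | add u v hu hv => simp only [map_add, hu, hv]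
    | tmul a b => simp [pair₂, pairing_tmul, toForm_dualAntipode]

theorem toForm_mul_lTensor (z : DualSteenrodAlgebra ⊗[ZMod 2] DualSteenrodAlgebra)
    (x : SteenrodAlgebra) : toForm (LinearMap.mul' (ZMod 2) DualSteenrodAlgebra
      (dualAntipode.lTensor DualSteenrodAlgebra z)) x =
      pair₂ z (antipodeAux.lTensor SteenrodAlgebra (Coalgebra.comul (R := ZMod 2) x)) := by
  induction z using TensorProduct.induction_on with
  | zero => simp
  | add u v hu hv => simp only [map_add, LinearMap.add_apply, hu, hv]
  | tmul f g =>
    rw [LinearMap.lTensor_tmul, LinearMap.mul'_apply, toForm_mul]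
    induction Coalgebra.comul (R := ZMod 2) x using TensorProduct.induction_on with
    | zero => simp
    | add u v hu hv => simp only [map_add, hu, hv]
    | tmul a b => simp [pair₂, pairing_tmul, toForm_dualAntipode]

noncomputable instance : HopfAlgebra (ZMod 2) DualSteenrodAlgebra where
  antipode := dualAntipode
  mul_antipode_rTensor_comul := by
    ext f
    apply toForm_injective
    ext x
    rw [LinearMap.comp_apply, LinearMap.comp_apply, toForm_mul_rTensor]
    refine (pair₂_dualComul f _).trans ?_
    have h := HopfAlgebra.mul_antipode_rTensor_comul_apply (R := ZMod 2) x
    change LinearMap.mul' (ZMod 2) SteenrodAlgebra (antipodeAux.rTensor _ _) = _ at h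
    rw [h, Algebra.algebraMap_eq_smul_one, map_smul, smul_eq_mul, mul_comm]
    exact (toForm_algebraMap _ _).symm
  mul_antipode_lTensor_comul := by
    ext f
    apply toForm_injective
    ext x
    rw [LinearMap.comp_apply, LinearMap.comp_apply, toForm_mul_lTensor]
    refine (pair₂_dualComul f _).trans ?_
    have h := HopfAlgebra.mul_antipode_lTensor_comul_apply (R := ZMod 2) x
    change LinearMap.mul' (ZMod 2) SteenrodAlgebra (antipodeAux.lTensor _ _) = _ at h
    rw [h, Algebra.algebraMap_eq_smul_one, map_smul, smul_eq_mul, mul_comm]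
    exact (toForm_algebraMap _ _).symm

end Dual

section Milnor
open scoped TensorProduct

/-- Admissible sequences: positive entries `j₁, j₂, …` with `j_{k-1} ≥ 2 j_k`. -/
def Admissible (J : List ℕ) : Prop := (∀ j ∈ J, 0 < j) ∧ J.IsChain fun a b => 2 * b ≤ a

/-- The sequence `2 ^ (n - 1), 2 ^ (n - 2), …, 2, 1`. -/
def xiSeq (n : ℕ) : List ℕ := (List.range n).reverse.map (2 ^ ·)

theorem xiSeq_zero : xiSeq 0 = [] := rfl

theorem xiSeq_succ (n : ℕ) : xiSeq (n + 1) = 2 ^ n :: xiSeq n := by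
  simp [xiSeq, List.range_succ]

/-- The moment of a sequence. -/
def moment : List ℕ → ℕ
  | [] => 0
  | a :: I => (a :: I).sum + moment I

theorem moment_append_lt (P : List ℕ) {I J : List ℕ} (hs : I.sum = J.sum)
    (h : moment I < moment J) : moment (P ++ I) < moment (P ++ J) := by
  induction P with
  | nil => exact h
  | cons a P ih =>
    simp only [List.cons_append, moment, List.sum_cons, List.sum_append, hs]
    omega

theorem admissible_or (I : List ℕ) (h : ∀ i ∈ I, 0 < i) : Admissible I ∨
    ∃ P i j Q, I = P ++ i :: j :: Q ∧ i < 2 * j := by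
  induction I with
  | nil => exact Or.inl ⟨h, by simp⟩
  | cons a I ih =>
    rcases ih fun i hi => h i (List.mem_cons_of_mem _ hi) with h1 | ⟨P, i, j, Q, rfl, hij⟩
    · rcases I with _ | ⟨b, I⟩
      · exact Or.inl ⟨h, by simp⟩
      · rcases le_or_gt (2 * b) a with hab | hab
        · exact Or.inl ⟨h, List.isChain_cons_cons.2 ⟨hab, h1.2⟩⟩
        · exact Or.inr ⟨[], a, b, I, rfl, hab⟩
    · exact Or.inr ⟨a :: P, i, j, Q, rfl, hij⟩

theorem SqWord_mem_admissible (I : List ℕ) (hI : ∀ i ∈ I, 0 < i) :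
    SqWord I ∈ Submodule.span (ZMod 2) (SqWord '' {J | Admissible J}) := by
  induction hm : moment I using Nat.strong_induction_on generalizing I with
  | _ m ih =>
    rcases admissible_or I hI with h | ⟨P, i, j, Q, rfl, hij⟩
    · exact Submodule.subset_span ⟨I, h, rfl⟩
    have hi : 0 < i := hI i (by simp)
    have hj : 0 < j := hI j (by simp)
    have hP : ∀ x ∈ P, 0 < x := fun x hx => hI x (by simp [hx])
    have hQ : ∀ x ∈ Q, 0 < x := fun x hx => hI x (by simp [hx])
    have h1 : SqWord (P ++ i :: j :: Q) = SqWord P * (Sq i * Sq j) * SqWord Q := by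
      rw [SqWord_append, SqWord_cons, SqWord_cons]; simp only [mul_assoc]
    have h2 : Sq i * Sq j = _ := ademRelations_Sq i j hi hij
    rw [h1, h2, Finset.mul_sum, Finset.sum_mul]
    refine Submodule.sum_mem _ fun k hk => ?_
    rw [Finset.mem_range] at hk
    rw [mul_smul_comm, smul_mul_assoc]
    refine Submodule.smul_mem _ _ ?_
    rcases Nat.eq_zero_or_pos k with rfl | hk0
    · have h3 : SqWord P * (Sq (i + j - 0) * Sq 0) * SqWord Q = SqWord (P ++ (i + j) :: Q) := by
        rw [SqWord_append, SqWord_cons, Sq_zero]; simp only [mul_assoc, one_mul, Nat.sub_zero]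
      rw [h3]
      refine ih _ ?_ _ ?_ rfl
      · rw [← hm]
        refine moment_append_lt P (by simp [add_assoc]) ?_
        simp only [moment, List.sum_cons]; omega
      · intro x hx
        simp only [List.mem_append, List.mem_cons] at hx
        rcases hx with hx | rfl | hx
        · exact hP x hx
        · omega
        · exact hQ x hx
    · have h3 : SqWord P * (Sq (i + j - k) * Sq k) * SqWord Q =
          SqWord (P ++ (i + j - k) :: k :: Q) := by
        rw [SqWord_append, SqWord_cons, SqWord_cons]; simp only [mul_assoc]
      rw [h3]
      refine ih _ ?_ _ ?_ rfl
      · rw [← hm]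
        refine moment_append_lt P (by simp only [List.sum_cons]; omega) ?_
        simp only [moment, List.sum_cons]; omega
      · intro x hx
        simp only [List.mem_append, List.mem_cons] at hx
        rcases hx with hx | rfl | rfl | hx
        · exact hP x hx
        · omega
        · exact hk0
        · exact hQ x hx

/-- The admissible monomials span the Steenrod algebra. -/
theorem span_admissible : Submodule.span (ZMod 2) (SqWord '' {J | Admissible J}) = ⊤ := by
  rw [eq_top_iff, ← span_SqWord, Submodule.span_le]
  rintro _ ⟨I, rfl⟩
  rw [← SqWord_filter]
  exact SqWord_mem_admissible _ fun i hi => by simpa using (List.mem_filter.1 hi).2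

/-- The action of `Sqⁿ` on sequences: the element `x ^ (2 ^ r)` goes to `x ^ (2 ^ (r + 1))` under
`Sq^(2 ^ r)`, and to zero under the other squares of positive degree. -/
def shiftAux (n : ℕ) : Module.End (ZMod 2) (ℕ → ZMod 2) where
  toFun g r := match r with
    | 0 => 0
    | s + 1 => if n = 2 ^ s then g s else 0
  map_add' f g := by
    funext r
    rcases r with _ | s
    · simp
    · simp only [Pi.add_apply]; split_ifs <;> simp
  map_smul' c g := by
    funext r
    rcases r with _ | s
    · simp
    · simp

/-- The operators `shiftAux n` for `n > 0`, and the identity for `n = 0`. -/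
def shift (n : ℕ) : Module.End (ZMod 2) (ℕ → ZMod 2) := if n = 0 then 1 else shiftAux n

theorem shift_zero : shift 0 = 1 := if_pos rfl

theorem shift_apply_zero {n : ℕ} (hn : 0 < n) (g : ℕ → ZMod 2) : shift n g 0 = 0 := by
  rw [shift, if_neg hn.ne']; rfl

theorem shift_apply_succ {n : ℕ} (hn : 0 < n) (g : ℕ → ZMod 2) (s : ℕ) :
    shift n g (s + 1) = if n = 2 ^ s then g s else 0 := by
  rw [shift, if_neg hn.ne']; rfl

theorem shift_mul_eq_zero {i j : ℕ} (hi : 0 < i) (hj : 0 < j) (h : i ≠ 2 * j) :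
    shift i * shift j = 0 := by
  refine LinearMap.ext fun g => funext fun r => ?_
  change shift i (shift j g) r = 0
  rcases r with _ | _ | s
  · exact shift_apply_zero hi _
  · rw [shift_apply_succ hi, shift_apply_zero hj, ite_self]
  · rw [shift_apply_succ hi, shift_apply_succ hj]
    split_ifs with h1 h2
    · exact absurd (by rw [h1, h2, pow_succ, mul_comm]) h
    · rfl
    · rfl

theorem ademRelations_shift : AdemRelations fun i j => shift i * shift j := by
  intro i j hi hij
  simp only
  rw [shift_mul_eq_zero hi (by omega) (by omega)]
  refine (Finset.sum_eq_zero fun k hk => ?_).symm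
  rw [Finset.mem_range] at hk
  rcases Nat.eq_zero_or_pos k with rfl | hk0
  · by_cases h : ∃ m, i + j = 2 ^ m
    · obtain ⟨m, hm⟩ := h
      have := choose_two_pow_sub m i j hi hm
      simp only [Nat.sub_zero, Nat.mul_zero]
      rw [this, zero_smul]
    · have : shift (i + j - 0) = 0 := by
        refine LinearMap.ext fun g => funext fun r => ?_
        rcases r with _ | s
        · exact shift_apply_zero (by omega) _
        · rw [shift_apply_succ (by omega), if_neg fun hs => h ⟨s, by omega⟩]; rfl
      rw [this, zero_mul, smul_zero]
  · rw [shift_mul_eq_zero (by omega) hk0 (by omega), smul_zero]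

/-- The Steenrod algebra acts through the operators `shift n`. -/
noncomputable def shiftRep : SteenrodAlgebra →ₐ[ZMod 2] Module.End (ZMod 2) (ℕ → ZMod 2) :=
  liftAdem (FreeAlgebra.lift (ZMod 2) fun n : ℕ+ => shift n) (by
    simp only [lift_S shift shift_zero]
    exact ademRelations_shift)

theorem shiftRep_Sq (n : ℕ) : shiftRep (Sq n) = shift n :=
  (liftAdem_proj _ _ _).trans (lift_S shift shift_zero n)

/-- The linear form underlying `ξₙ`. -/
noncomputable def xiForm (n : ℕ) : Module.Dual (ZMod 2) SteenrodAlgebra :=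
  LinearMap.proj n ∘ₗ LinearMap.applyₗ (Pi.single 0 1 : ℕ → ZMod 2) ∘ₗ shiftRep.toLinearMap

theorem xiForm_one (n : ℕ) : xiForm n 1 = if n = 0 then 1 else 0 := by
  simp [xiForm, Pi.single_apply]

theorem xiForm_Sq_mul_zero {i : ℕ} (hi : 0 < i) (x : SteenrodAlgebra) :
    xiForm 0 (Sq i * x) = 0 := by
  simp [xiForm, shiftRep_Sq, shift_apply_zero hi]

theorem xiForm_Sq_mul_succ {i : ℕ} (hi : 0 < i) (x : SteenrodAlgebra) (n : ℕ) :
    xiForm (n + 1) (Sq i * x) = if i = 2 ^ n then xiForm n x else 0 := by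
  simp [xiForm, shiftRep_Sq, shift_apply_succ hi]

theorem xiForm_SqWord (n : ℕ) (I : List ℕ) (hI : ∀ i ∈ I, 0 < i) :
    xiForm n (SqWord I) = if I = xiSeq n then 1 else 0 := by
  induction I generalizing n with
  | nil =>
    rw [SqWord_nil, xiForm_one]
    rcases n with _ | n
    · simp [xiSeq_zero]
    · simp [xiSeq_succ]
  | cons i I ih =>
    have hi : 0 < i := hI i (by simp)
    rw [SqWord_cons]
    rcases n with _ | n
    · rw [xiForm_Sq_mul_zero hi, xiSeq_zero, if_neg (by simp)]
    · rw [xiForm_Sq_mul_succ hi, ih n fun x hx => hI x (by simp [hx]), xiSeq_succ]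
      by_cases h1 : i = 2 ^ n <;> by_cases h2 : I = xiSeq n <;> simp [h1, h2]

theorem sum_xiSeq (n : ℕ) : (xiSeq n).sum + 1 = 2 ^ n := by
  induction n with
  | zero => rfl
  | succ n ih => rw [xiSeq_succ, List.sum_cons, pow_succ]; omega

/-- There is exactly one element of the dual Steenrod algebra that takes the value `1` on the
admissible monomial `Sq^{2^{n-1}} ⋯ Sq² Sq¹` and `0` on all other admissible monomials. -/
theorem existsUnique_xi (n : ℕ) : ∃! f : DualSteenrodAlgebra,
    ∀ J : List ℕ, Admissible J → toForm f (SqWord J) = if J = xiSeq n then 1 else 0 := by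
  refine ⟨ofForm (xiForm n) ⟨2 ^ n, fun I hI => ?_⟩, fun J hJ => xiForm_SqWord n J hJ.1, ?_⟩
  · rw [← SqWord_filter, xiForm_SqWord _ _ fun i hi => by simpa using (List.mem_filter.1 hi).2,
      if_neg]
    intro h
    have h1 := sum_filter_pos I
    have h2 := sum_xiSeq n
    rw [h] at h1
    omega
  · intro f hf
    apply toForm_injective
    refine LinearMap.ext_on span_admissible ?_
    rintro _ ⟨J, hJ, rfl⟩
    rw [hf J hJ]
    exact (xiForm_SqWord n J hJ.1).symm

/-- Milnor's element `ξₙ = Sq_{2^{n-1}, …, 2, 1}` of the dual Steenrod algebra: the dual basis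
element with index `(2^{n-1}, …, 2, 1)`, i.e. the element whose value on `Sq^J`, for `J` admissible,
is `1` if `J = (2^{n-1}, …, 2, 1)` and `0` otherwise. In particular `ξ₀ = 1`. -/
noncomputable def xi (n : ℕ) : DualSteenrodAlgebra := (existsUnique_xi n).choose

end Milnor

end Steenrod

namespace Steenrod
-- The elements ξₙ as linear forms
section MilnorCoproduct
open Finset.HasAntidiagonal (antidiagonal)
open scoped TensorProduct

/-! The formula is the solution of a recursion that comes from Milnor's coproduct Δ(ξₙ) = ∑_{i+j=n}
ξ_i^{2^j} ⊗ ξ_j (`comul_xi`). Applying m(1 ⊗ χ) to it gives ∑ ξ_i^{2^j} χ(ξ_j) = 0 for n > 0. Since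
ξ₀ = 1, and signs do not matter in characteristic 2, this determines χ(ξ_{n+1}) = ∑_{i≤n} χ(ξ_i)
ξ_{n+1-i}^{2^i} (`antipode_xi_succ`). Removing the last block n+1-i of a composition of n+1 leaves a
composition of i, and i is exactly the partial sum σ attached to that block. So the sum over
compositions satisfies the same recursion (`sum_composition_succ`, `prod_append_singleton`).

For the coproduct, let Sq^k act on the dual algebra by (f · Sq^k)(x) = f(Sq^k x). The coproduct of
Sq^k makes this action satisfy the Cartan formula, so the total operation T(f) = ∑ (f · Sq^k) X^k is
multiplicative (`totalTranslate`). The form ξₙ reads off the coefficient of x^{2^n} in θx, where θ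
acts on the span of the x^{2^r} and Sq^k sends x^{2^r} to x^{2^{r+1}} if k = 2^r and to 0 for other
k > 0. Hence T(ξ_{n+1}) = ξ_{n+1} + ξ_n X^{2^n}. Taking 2^i-th powers in characteristic 2 gives
T(ξ_{n+1}^{2^i}) = ξ_{n+1}^{2^i} + ξ_n^{2^i} X^{2^{n+i}} (`translate_xi_succ_pow`). Both sides of
the coproduct formula therefore change in the same way when one more square is put in front of a
monomial, and induction on the length of the monomial proves it (`toForm_xi_SqWord_mul`). -/

theorem toForm_xi_SqWord (n : ℕ) {J : List ℕ} (hJ : Admissible J) :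
    toForm (xi n) (SqWord J) = if J = xiSeq n then 1 else 0 :=
  (existsUnique_xi n).choose_spec.1 J hJ

/-- Two forms that agree on the admissible monomials are equal, because these span. This replaces
the characterization of ξₙ by a matrix coefficient of the representation `shiftRep`, which can be
evaluated on arbitrary products and not only on admissible ones. -/
theorem toForm_xi (n : ℕ) : toForm (xi n) = xiForm n := by
  refine LinearMap.ext_on span_admissible ?_
  rintro _ ⟨J, hJ, rfl⟩
  rw [toForm_xi_SqWord n hJ, xiForm_SqWord n J hJ.1]

/-- The unit of the dual algebra is the counit of the Steenrod algebra. It vanishes on every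
nonempty admissible monomial, since such a monomial has positive degree. -/
theorem xi_zero : xi 0 = 1 := by
  apply toForm_injective
  refine LinearMap.ext_on span_admissible ?_
  rintro _ ⟨J, hJ, rfl⟩
  rw [toForm_xi_SqWord 0 hJ, toForm_one, xiSeq_zero]
  rcases J with _ | ⟨j, J⟩
  · simp [SqWord_nil]
  · rw [if_neg (by simp), counit_SqWord]
    have := hJ.1 j (by simp)
    simp only [List.sum_cons]; omega

instance : Nontrivial DualSteenrodAlgebra :=
  ⟨1, 0, fun h => by
    have := congrArg (fun f => toForm f 1) h
    simp only [toForm_one, map_zero, LinearMap.zero_apply, Bialgebra.counit_one] at this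
    exact one_ne_zero this⟩

/-- This makes the 2^i-th power map additive on the power series in which the total operation takes
its values. -/
instance : CharP (PowerSeries DualSteenrodAlgebra) 2 :=
  charP_of_injective_algebraMap
    (FaithfulSMul.algebraMap_injective (ZMod 2) (PowerSeries DualSteenrodAlgebra)) 2

/-! ### Action of the total square on the dual algebra -/

theorem translate_one_Sq (k : ℕ) : translate 1 (Sq k) = if k = 0 then 1 else 0 := by
  apply toForm_injective
  ext x
  rw [toForm_translate, toForm_one, Bialgebra.counit_mul, counit_Sq]
  split_ifs <;> simp [toForm_one]

/-- The Cartan formula for the action of the squares on the dual Steenrod algebra. -/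
theorem translate_mul_Sq (f g : DualSteenrodAlgebra) (k : ℕ) : translate (f * g) (Sq k) =
    ∑ p ∈ antidiagonal k, translate f (Sq p.1) * translate g (Sq p.2) := by
  apply toForm_injective
  ext x
  rw [toForm_translate, toForm_mul, Bialgebra.comul_mul, comul_Sq, map_sum, LinearMap.sum_apply]
  simp only [toForm_mul]
  -- Both sides are now linear in Δ(x), so Δ(x) may be replaced by a pure tensor a ⊗ b.
  induction Coalgebra.comul (R := ZMod 2) x using TensorProduct.induction_on with
  | zero => simp
  | add u v hu hv => simp only [mul_add, map_add, hu, hv, Finset.sum_add_distrib]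
  | tmul a b => simp [Finset.sum_mul, toForm_translate]

/-- The action of the total square on the dual Steenrod algebra, a multiplicative map. -/
noncomputable def totalTranslate : DualSteenrodAlgebra →* PowerSeries DualSteenrodAlgebra where
  toFun f := PowerSeries.mk fun k => translate f (Sq k)
  map_one' := by
    ext k
    rw [PowerSeries.coeff_mk, translate_one_Sq, PowerSeries.coeff_one]
  map_mul' f g := by
    ext k
    simp only [PowerSeries.coeff_mul, PowerSeries.coeff_mk, translate_mul_Sq]

theorem coeff_totalTranslate (f : DualSteenrodAlgebra) (k : ℕ) :
    PowerSeries.coeff k (totalTranslate f) = translate f (Sq k) :=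
  PowerSeries.coeff_mk k fun k => translate f (Sq k)

theorem translate_Sq_zero (f : DualSteenrodAlgebra) : translate f (Sq 0) = f := by
  apply toForm_injective
  ext x
  rw [toForm_translate, Sq_zero, one_mul]

/-- In the representation on the span of the x^{2^r}, a square of positive degree can produce
x^{2^{n+1}} only from x^{2^n}, and only if its degree is 2^n. -/
theorem translate_xi_succ {k : ℕ} (hk : 0 < k) (n : ℕ) :
    translate (xi (n + 1)) (Sq k) = if k = 2 ^ n then xi n else 0 := by
  apply toForm_injective
  ext x
  rw [toForm_translate, toForm_xi, xiForm_Sq_mul_succ hk]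
  split_ifs <;> simp [toForm_xi]

theorem totalTranslate_xi_succ (n : ℕ) : totalTranslate (xi (n + 1)) =
    PowerSeries.C (xi (n + 1)) + PowerSeries.C (xi n) * PowerSeries.X ^ 2 ^ n := by
  ext k
  rw [coeff_totalTranslate, map_add, PowerSeries.coeff_C, PowerSeries.coeff_C_mul,
    PowerSeries.coeff_X_pow]
  -- The constant term is separate because Sq⁰ = 1 acts as the identity. The other summand does not
  -- interfere with it, as 2^n > 0.
  rcases Nat.eq_zero_or_pos k with rfl | hk
  · rw [translate_Sq_zero, if_pos rfl, if_neg (by positivity), mul_zero, add_zero]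
  · rw [translate_xi_succ hk, if_neg hk.ne', zero_add, mul_ite, mul_one, mul_zero]

/-- The total operation is multiplicative and its value on ξ_{n+1} has two terms. In characteristic
2 a 2^i-th power is taken term by term, which multiplies the exponent 2^n of X by 2^i. -/
theorem translate_xi_succ_pow {k : ℕ} (hk : 0 < k) (n i : ℕ) :
    translate (xi (n + 1) ^ 2 ^ i) (Sq k) = if k = 2 ^ (n + i) then xi n ^ 2 ^ i else 0 := by
  rw [← coeff_totalTranslate, map_pow, totalTranslate_xi_succ, add_pow_char_pow, mul_pow,
    ← map_pow, ← map_pow, ← pow_mul, ← pow_add, map_add, PowerSeries.coeff_C,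
    PowerSeries.coeff_C_mul, PowerSeries.coeff_X_pow, if_neg hk.ne', zero_add, mul_ite, mul_one,
    mul_zero]

/-! ### Milnor's coproduct formula -/

/-- This is the coproduct formula evaluated on Sq^I ⊗ y. Removing the first square of Sq^I lowers n
by one on the left and the index of the first tensor factor by one on the right. The entries are
taken positive because Sq⁰ acts as the identity and lowers nothing. -/
theorem toForm_xi_SqWord_mul (I : List ℕ) (hI : ∀ i ∈ I, 0 < i) (y : SteenrodAlgebra) (n : ℕ) :
    toForm (xi n) (SqWord I * y) =
      ∑ p ∈ antidiagonal n, toForm (xi p.1 ^ 2 ^ p.2) (SqWord I) * toForm (xi p.2) y := by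
  induction I generalizing n with
  | nil =>
    have h : ∀ i m, toForm (xi m ^ 2 ^ i) 1 = if m = 0 then 1 else 0 := by
      intro i m
      -- Evaluation at 1 is the counit of the dual algebra, hence multiplicative.
      have h1 : toForm (xi m ^ 2 ^ i) 1 = toForm (xi m) 1 ^ 2 ^ i :=
        map_pow (Bialgebra.counitAlgHom (ZMod 2) DualSteenrodAlgebra) _ _
      rw [h1, toForm_xi, xiForm_one]
      split_ifs <;> simp
    -- On the empty word only the term with ξ₀ = 1 in the first factor survives.
    rw [SqWord_nil, one_mul, Finset.sum_eq_single (0, n)]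
    · simp [h]
    · intro p hp hne
      rw [Finset.HasAntidiagonal.mem_antidiagonal] at hp
      rw [h, if_neg, zero_mul]
      intro h0
      exact hne (Prod.ext h0 (by simp only; omega))
    · simp
  | cons k I ih =>
    have hk : 0 < k := hI k (by simp)
    simp only [SqWord_cons, mul_assoc, ← toForm_translate _ (Sq k)]
    rcases n with _ | n
    · simp [xi_zero, translate_one_Sq, hk.ne']
    -- The term split off has a power of ξ₀ = 1 as its first factor, and Sq^k with k > 0 annihilates
    -- 1. The other terms have first index p.1 + 1.
    · rw [Finset.Nat.sum_antidiagonal_succ, translate_xi_succ hk]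
      simp only [translate_xi_succ_pow hk, xi_zero, one_pow, translate_one_Sq, hk.ne', if_false,
        map_zero, LinearMap.zero_apply, zero_mul, zero_add]
      -- The condition on k reads k = 2^{p.1+p.2} = 2^n in every term. It is thus the same for the
      -- whole sum, and the same as on the left-hand side. This is why the exponent 2^j appears in
      -- the coproduct.
      have h : ∀ p ∈ antidiagonal n,
          toForm (if k = 2 ^ (p.1 + p.2) then xi p.1 ^ 2 ^ p.2 else 0) (SqWord I) *
            toForm (xi p.2) y =
          if k = 2 ^ n then toForm (xi p.1 ^ 2 ^ p.2) (SqWord I) * toForm (xi p.2) y else 0 := by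
        intro p hp
        rw [Finset.HasAntidiagonal.mem_antidiagonal.1 hp]
        split_ifs <;> simp
      rw [Finset.sum_congr rfl h]
      split_ifs
      · exact ih (fun i hi => hI i (by simp [hi])) n
      · simp

/-- Milnor's formula for the coproduct of `ξₙ`. -/
theorem comul_xi (n : ℕ) : Coalgebra.comul (R := ZMod 2) (xi n) =
    ∑ p ∈ antidiagonal n, (xi p.1 ^ 2 ^ p.2) ⊗ₜ[ZMod 2] xi p.2 := by
  apply pair₂_injective
  refine TensorProduct.ext' fun x y => ?_
  refine (pair₂_dualComul (xi n) _).trans ?_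
  rw [LinearMap.mul'_apply, map_sum, LinearMap.sum_apply]
  simp only [pair₂, pairing_tmul]
  -- For fixed y both sides are linear forms in x, so x may be a monomial, from which the factors
  -- Sq⁰ = 1 are deleted to make all entries positive.
  have h : toForm (xi n) ∘ₗ LinearMap.mulRight (ZMod 2) y =
      ∑ p ∈ antidiagonal n, toForm (xi p.2) y • toForm (xi p.1 ^ 2 ^ p.2) := by
    refine linearMap_ext_SqWord fun I => ?_
    rw [← SqWord_filter, LinearMap.comp_apply, LinearMap.mulRight_apply,
      toForm_xi_SqWord_mul _ fun i hi => by simpa using (List.mem_filter.1 hi).2]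
    simp [mul_comm]
  have := LinearMap.congr_fun h x
  simpa [mul_comm] using this

/-! ### The recursion for the conjugates -/

theorem sum_xi_pow_mul_antipode {n : ℕ} (hn : 0 < n) :
    ∑ p ∈ antidiagonal n, xi p.1 ^ 2 ^ p.2 * HopfAlgebra.antipode (ZMod 2) (xi p.2) = 0 := by
  have h := HopfAlgebra.mul_antipode_lTensor_comul_apply (R := ZMod 2) (xi n)
  -- The right-hand side of the antipode identity is the counit of ξₙ, its value at 1, which
  -- vanishes for n > 0.
  have h0 : Coalgebra.counit (R := ZMod 2) (xi n) = 0 := by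
    change toForm (xi n) 1 = 0
    rw [toForm_xi, xiForm_one, if_neg hn.ne']
  rw [comul_xi, map_sum, map_sum, h0, map_zero] at h
  simpa using h

/-- In the preceding relation the term containing χ(ξ_{n+1}) has coefficient a power of ξ₀ = 1, so
the relation can be solved for it. The minus sign disappears because 2 = 0. -/
theorem antipode_xi_succ (n : ℕ) : HopfAlgebra.antipode (ZMod 2) (xi (n + 1)) =
    ∑ i ∈ Finset.range (n + 1),
      HopfAlgebra.antipode (ZMod 2) (xi i) * xi (n + 1 - i) ^ 2 ^ i := by
  have h := sum_xi_pow_mul_antipode n.succ_pos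
  -- After the swap the summation index is that of χ(ξ_i), so the term to be isolated is the last
  -- one.
  rw [← Finset.Nat.sum_antidiagonal_swap] at h
  simp only [Prod.fst_swap, Prod.snd_swap] at h
  rw [Finset.Nat.sum_antidiagonal_eq_sum_range_succ
    (fun i j => xi j ^ 2 ^ i * HopfAlgebra.antipode (ZMod 2) (xi i)), Finset.sum_range_succ,
    Nat.sub_self, xi_zero, one_pow, one_mul] at h
  have h2 : (2 : DualSteenrodAlgebra) = 0 := by
    rw [← map_ofNat (algebraMap (ZMod 2) DualSteenrodAlgebra) 2,
      show (OfNat.ofNat 2 : ZMod 2) = 0 from rfl, map_zero]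
  rw [eq_neg_of_add_eq_zero_right h]
  simp only [mul_comm (xi _ ^ _)]
  rw [neg_eq_iff_add_eq_zero, ← two_mul, h2, zero_mul]

end MilnorCoproduct

/-! ### Splitting off the last block of a composition -/

section Compositions

/-- A sum over the compositions of a positive integer, sorted by the last block. -/
theorem sum_composition_succ {E : Type*} [AddCommMonoid E] (G : List ℕ → E) (n : ℕ) :
    ∑ c : Composition (n + 1), G c.blocks = ∑ i ∈ Finset.range (n + 1),
      ∑ c : Composition i, G (c.blocks ++ [n + 1 - i]) := by
  rw [← Fin.sum_univ_eq_sum_range (fun i => ∑ c : Composition i, G (c.blocks ++ [n + 1 - i])),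
    ← Fintype.sum_sigma' (fun (i : Fin (n + 1)) (c : Composition i) =>
      G (c.blocks ++ [n + 1 - (i : ℕ)]))]
  symm
  -- Appending the block n + 1 - i completes a composition of i to one of n + 1. The block is
  -- positive because i ≤ n.
  let e : (Σ i : Fin (n + 1), Composition i) → Composition (n + 1) := fun x =>
    ⟨x.2.blocks ++ [n + 1 - (x.1 : ℕ)], by
      intro i hi
      rw [List.mem_append, List.mem_singleton] at hi
      rcases hi with hi | rfl
      · exact x.2.blocks_pos hi
      · have := x.1.2
        omega, by
      have := x.1.2
      rw [List.sum_append, x.2.blocks_sum, List.sum_singleton]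
      omega⟩
  refine Fintype.sum_bijective e ⟨?_, ?_⟩ _ _ fun x => rfl
  · rintro ⟨⟨i, hi⟩, c⟩ ⟨⟨j, hj⟩, d⟩ h
    obtain ⟨h1, h2⟩ := List.append_inj' (congrArg Composition.blocks h) rfl
    -- The remaining blocks determine i as their sum. The two indices must be identified before `c`
    -- and `d` have the same type.
    obtain rfl : i = j := by simpa [c.blocks_sum, d.blocks_sum] using congrArg List.sum h1
    obtain rfl : c = d := Composition.ext h1
    rfl
  · intro c
    -- A composition of n + 1 is nonempty, so it has a last block a. The preimage is the composition
    -- of the sum of the other blocks, which is at most n because a > 0.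
    rcases List.eq_nil_or_concat c.blocks with h | ⟨l, a, h⟩
    · exact absurd (c.blocks_eq_nil.1 h) n.succ_ne_zero
    have hs := c.blocks_sum
    rw [h] at hs
    simp only [List.concat_eq_append, List.sum_append, List.sum_singleton] at hs
    have ha : 0 < a := c.blocks_pos (by simp [h])
    refine ⟨⟨⟨l.sum, by omega⟩, ⟨l, fun hi => c.blocks_pos (by simp [h, hi]), rfl⟩⟩, ?_⟩
    apply Composition.ext
    simp only [e, h, List.concat_eq_append]
    congr 2
    omega

/-- The entries of l and the partial sums before them do not see the appended entry, and the sum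
before that entry is the sum of l. -/
theorem prod_append_singleton {E : Type*} [CommMonoid E] (F : ℕ → ℕ → E) (l : List ℕ) (a : ℕ) :
    ∏ k : Fin (l ++ [a]).length, F ((l ++ [a]).get k) ((l ++ [a]).take k).sum =
      (∏ k : Fin l.length, F (l.get k) (l.take k).sum) * F a l.sum := by
  -- Indexing by natural numbers avoids comparing `Fin` types of different lengths. The default
  -- value 0 is never used, since k stays below the length.
  have h : ∀ l : List ℕ, ∏ k : Fin l.length, F (l.get k) (l.take k).sum =
      ∏ k ∈ Finset.range l.length, F (l.getD k 0) (l.take k).sum := by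
    intro l
    rw [← Fin.prod_univ_eq_prod_range (fun k => F (l.getD k 0) (l.take k).sum)]
    refine Finset.prod_congr rfl fun k _ => ?_
    simp
  rw [h, h, List.length_append, List.length_singleton, Finset.prod_range_succ]
  congr 1
  · refine Finset.prod_congr rfl fun k hk => ?_
    rw [Finset.mem_range] at hk
    rw [List.getD_append _ _ _ _ hk, List.take_append_of_le_length hk.le]
  · simp

end Compositions

end Steenrod

theorem corollary5p8 (n : ℕ) :
    HopfAlgebra.antipode (ZMod 2) (Steenrod.xi n) =
      ∑ α : Composition n, ∏ k : Fin α.length,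
        Steenrod.xi (α.blocksFun k) ^ 2 ^ α.sizeUpTo k := by
  induction n using Nat.strong_induction_on with
  | _ n ih =>
    rcases n with _ | n
    -- The empty composition is the only composition of 0, and its product is empty.
    · rw [Steenrod.xi_zero, HopfAlgebra.antipode_one, Fintype.sum_eq_single (Composition.ones 0)]
      · rfl
      · intro c hc
        refine absurd (Composition.ext ?_) hc
        rw [c.blocks_eq_nil.2 rfl, Composition.ones_blocks, List.replicate_zero]
    · rw [Steenrod.antipode_xi_succ]
      -- By definition the product attached to a composition depends only on its list of blocks, so
      -- compositions of different integers can be compared through their lists.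
      refine Eq.trans ?_ (Steenrod.sum_composition_succ (fun l => ∏ k : Fin l.length,
        Steenrod.xi (l.get k) ^ 2 ^ (l.take k).sum) n).symm
      refine Finset.sum_congr rfl fun i hi => ?_
      rw [ih i (Finset.mem_range.1 hi), Finset.sum_mul]
      refine Finset.sum_congr rfl fun c _ => ?_
      -- The blocks before the last one sum to i, which yields the exponent 2^i of the recursion.
      rw [Steenrod.prod_append_singleton (fun a s => Steenrod.xi a ^ 2 ^ s), c.blocks_sum]
      rfl
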